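/- Let $G$ be a group with no non-trivial finite normal subgroup, acting by isometries on a geodesic $\delta$-hyperbolic metric space $X$. Assume that $X$ is non-elementary (its Gromov boundary has more than two points), and that the action is - acylindrical: for every $\epsilon>0$ there are $M,N\ge 0$ such that for all $x,y\in X$ with $d(x,y)\ge M$ at most $N$ elements $g\in G$ satisfy $d(x,gx)\le\epsilon$ and $d(y,gy)\le\epsilon$; - cobounded: there is a bounded set $B\subseteq X$ with $G\cdot B=X$. An element $g\in G$ is elliptic if $\{g^n s : n\in\mathbb Z\}$ is bounded for some (equivalently any) $s\in X$, and loxodromic if $n\mapsto g^n s$ is a quasi-isometric embedding $\mathbb Z\to X$ for some (equivalently any) $s\in X$. A subgroup is elliptic if all its elements are elliptic. For $r,K\in\mathbb R$, an element $g \in G$ and a subgroup $H \le G$ put $A_r(g)=\{x\in X: d(x,gx)\le \inf_{y\in X} d(y,gy)+r\}$ and $\mathrm{Fix}_K(H)=\{x\in X: d(x,hx)\le K\ \text{for all } h\in H\}$. Let $H_1,\dots,H_k$ be finitely many subgroups of $G$ that are elliptic for this action. Then there is a loxodromic element $g\in G$ such that 1. for every $i$ with $H_i\ne\{1\}$ and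 all $r,K$, the set $A_r(g)\cap \mathrm{Fix}_K(H_i)$ is bounded; 2. for all sufficiently large $N$, the element $\gamma=g^N$ is loxodromic (in particular of infinite order) and, for every $i=1,\dots,k$, $\langle\gamma,H_i\rangle=\langle\gamma\rangle * H_i$, i.e. the canonical homomorphism from the free product $\langle\gamma\rangle * H_i$ to $G$ is injective with image $\langle\gamma,H_i\rangle$. -/

import Mathlib

open Filter Set

namespace AcylindricalPingPong

noncomputable section

/-- The Gromov product `(x · y)_p`. -/
def gromovProduct {X : Type*} [MetricSpace X] (p x y : X) : ℝ :=
  (dist x p + dist y p - dist x y) / 2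

/-- Every two points of `X` are joined by a geodesic segment. -/
def IsGeodesicSpace (X : Type*) [MetricSpace X] : Prop :=
  ∀ x y : X, ∃ c : ℝ → X, c 0 = x ∧ c (dist x y) = y ∧
    ∀ s ∈ Icc (0 : ℝ) (dist x y), ∀ t ∈ Icc (0 : ℝ) (dist x y), dist (c s) (c t) = |s - t|

/-- `δ`-hyperbolicity in the sense of Gromov. -/
def IsHyperbolicSpace (δ : ℝ) (X : Type*) [MetricSpace X] : Prop :=
  ∀ p x y z : X,
    min (gromovProduct p x y) (gromovProduct p y z) - δ ≤ gromovProduct p x z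

/-- Sequences `u` of points that converge to infinity: `(u m · u n)_p → ∞` as `m, n → ∞`. -/
def SequenceToInfinity (X : Type*) [MetricSpace X] : Type _ :=
  {u : ℕ → X // ∀ p : X,
    Tendsto (fun i : ℕ × ℕ => gromovProduct p (u i.1) (u i.2)) atTop atTop}

/-- Two sequences converge to the same point at infinity: `(u n · v n)_p → ∞`. -/
def SameLimit {X : Type*} [MetricSpace X] (u v : SequenceToInfinity X) : Prop :=
  ∀ p : X, Tendsto (fun n : ℕ => gromovProduct p (u.1 n) (v.1 n)) atTop atTop

/-- In a hyperbolic space `SameLimit` is an equivalence relation. -/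
theorem sameLimit_equivalence {X : Type*} [MetricSpace X] {δ : ℝ}
    (hX : IsHyperbolicSpace δ X) : Equivalence (SameLimit (X := X)) where
  refl u p := (u.2 p).comp (tendsto_atTop_diagonal)
  symm {u v} h p := by
    refine (h p).congr fun n => ?_
    simp only [gromovProduct, dist_comm (v.1 n) (u.1 n)]
    ring
  trans {u v w} huv hvw p := by
    rw [tendsto_atTop]
    intro b
    filter_upwards [(tendsto_atTop.1 (huv p)) (b + δ), (tendsto_atTop.1 (hvw p)) (b + δ)]
      with n h1 h2
    have h := hX p (u.1 n) (v.1 n) (w.1 n)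
    have h3 := le_min h1 h2
    linarith

/-- The Gromov boundary `∂X` (for `X` hyperbolic), by equivalence classes of sequences
converging to infinity. -/
def GromovBoundary (X : Type*) [MetricSpace X] : Type _ :=
  Quot (SameLimit (X := X))

/-- A hyperbolic space is non-elementary if its Gromov boundary has more than two points. -/
def IsNonElementary (X : Type*) [MetricSpace X] : Prop :=
  2 < ENat.card (GromovBoundary X)

/-- A quasi-isometric embedding, for some multiplicative and some additive constant. -/
def IsQuasiIsometricEmbedding {Y X : Type*} [MetricSpace Y] [MetricSpace X] (f : Y → X) : Prop :=
  ∃ L C : ℝ, 1 ≤ L ∧ 0 ≤ C ∧ ∀ y z : Y,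
    dist y z / L - C ≤ dist (f y) (f z) ∧ dist (f y) (f z) ≤ L * dist y z + C

section Action

variable {G : Type*} [Group G] (X : Type*) [MetricSpace X] [MulAction G X]

/-- The action of `G` on `X` is acylindrical. -/
def IsAcylindrical (G : Type*) [Group G] (X : Type*) [MetricSpace X] [MulAction G X] : Prop :=
  ∀ ε : ℝ, 0 < ε → ∃ (M : ℝ) (N : ℕ), 0 ≤ M ∧ ∀ x y : X, M ≤ dist x y →
    {g : G | dist x (g • x) ≤ ε ∧ dist y (g • y) ≤ ε}.encard ≤ N

/-- The action of `G` on `X` is cobounded: the translates of some bounded set cover `X`. -/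
def IsCobounded (G : Type*) [Group G] (X : Type*) [MetricSpace X] [MulAction G X] : Prop :=
  ∃ B : Set X, Bornology.IsBounded B ∧ ∀ x : X, ∃ g : G, ∃ b ∈ B, g • b = x

/-- `g` is elliptic: the orbit of some point under the powers of `g` is bounded. -/
def IsElliptic (g : G) : Prop :=
  ∃ s : X, Bornology.IsBounded (range fun n : ℤ => g ^ n • s)

/-- A subgroup is elliptic if all its elements are elliptic. -/
def IsEllipticSubgroup (H : Subgroup G) : Prop :=
  ∀ h ∈ H, IsElliptic X h

/-- `g` is loxodromic: `n ↦ g ^ n • s` is a quasi-isometric embedding of `ℤ` for some `s`. -/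
def IsLoxodromic (g : G) : Prop :=
  ∃ s : X, IsQuasiIsometricEmbedding fun n : ℤ => g ^ n • s

/-- The `r`-quasi-axis `A_r(g)`: the set of `r`-quasi-minimal points of `g`. -/
def quasiAxis (r : ℝ) (g : G) : Set X :=
  {x : X | dist x (g • x) ≤ (⨅ y : X, dist y (g • y)) + r}

/-- The quasi-fixed set `Fix_K(H)`. -/
def quasiFix (K : ℝ) (H : Subgroup G) : Set X :=
  {x : X | ∀ h ∈ H, dist x (h • x) ≤ K}

end Action

/-- The subgroup `K` is the internal free product of its subgroups `A` and `B`: the canonical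
homomorphism from the free product of `A` and `B` to `G` is injective with image `K`. -/
def IsInternalFreeProduct {G : Type*} [Group G] (K A B : Subgroup G) : Prop :=
  Function.Injective (Monoid.Coprod.lift A.subtype B.subtype) ∧
    (Monoid.Coprod.lift A.subtype B.subtype).range = K

end

end AcylindricalPingPong

/-!
The proof is elementary hyperbolic geometry: quasi-axes are orbits `n ↦ f ^ n • s` of elements with
`d(s, f² s) > d(s, f s) + 3δ`, and the four-point inequality replaces geodesics and boundary points
almost everywhere.

*Elementary closures.* Let `E(f)` be the group of elements that conjugate a positive power of `f`
to itself or to its inverse. Acylindricity gives the rigidity statement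
`IsAcylindrical.exists_mem_elementaryClosure`: an element that moves a long piece of the quasi-axis
of `f` close to the quasi-axis lies in `E(f)`. Hence translates of the quasi-axis by elements
outside of `E(f)` project to bounded sets (`IsAcylindrical.exists_gromovProduct_le`), and
`E(f) ∩ a E(f) a⁻¹` is finite for `a ∉ E(f)`.

*It suffices to find `g` with `E(g) ∩ Hᵢ = 1` for all `i`.* Subgroups with unbounded orbits contain
loxodromic elements (`IsAcylindrical.exists_isStretchedAt`), so elliptic subgroups have bounded
orbits. Then non-trivial elements of `Hᵢ` move the quasi-axis of `g` to a quasi-line projecting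
near the base point, uniformly in the element, and high powers of `g` play ping-pong with `Hᵢ`. An
unbounded set of points moved little by both `g` and some `h` in `Hᵢ` would force `h ∈ E(g)`.

*Finding `g`.* Start from any element `f` with a quasi-axis. By non-elementarity and coboundedness,
`E(f)` is not all of `G`, so its normal core is finite, hence trivial. Given `a ∉ E(f)`, conjugating
`f` by a suitable high power of `a f a⁻¹` yields `f'` with
`E(f') ∩ Hᵢ ⊆ E(f) ∩ a E(f) a⁻¹ ∩ Hᵢ` for all `i`
(`IsAcylindrical.exists_conj_mem_elementaryClosure`). The right-hand side is finite, and for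
each `t ≠ 1` in it, triviality of the normal core provides an `a` such that the next conjugation
removes `t`. After finitely many steps nothing but `1` is left.
-/

namespace AcylindricalPingPong

/-! ### Gromov products and thin tripods -/

section Hyperbolic

variable {X : Type*} [MetricSpace X] {δ : ℝ}

theorem IsHyperbolicSpace.nonneg (hX : IsHyperbolicSpace δ X) (x : X) : 0 ≤ δ := by
  have h := hX x x x x
  simp [gromovProduct] at h
  exact h

theorem IsHyperbolicSpace.four_point (hX : IsHyperbolicSpace δ X) (x y z w : X) :
    dist x z + dist y w ≤ max (dist x y + dist z w) (dist x w + dist y z) + 2 * δ := by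
  have h := hX w x y z
  simp only [gromovProduct] at h
  rcases min_le_iff.1 (sub_le_iff_le_add.1 h) with h | h
  · have := le_max_left (dist x y + dist z w) (dist x w + dist y z)
    linarith
  · have := le_max_right (dist x y + dist z w) (dist x w + dist y z)
    linarith

theorem gromovProduct_comm (p x y : X) : gromovProduct p x y = gromovProduct p y x := by
  simp only [gromovProduct, dist_comm x y]
  ring

theorem gromovProduct_nonneg (p x y : X) : 0 ≤ gromovProduct p x y := by
  have := dist_triangle_right x y p
  simp only [gromovProduct]
  linarith

theorem gromovProduct_le_add_dist (p x y z : X) :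
    gromovProduct p x y ≤ gromovProduct p x z + dist y z := by
  have h1 := dist_triangle y z p
  have h2 := dist_triangle x y z
  simp only [gromovProduct]
  linarith

theorem gromovProduct_le_add_dist_base (p q x y : X) :
    gromovProduct p x y ≤ gromovProduct q x y + dist p q := by
  have h1 := dist_triangle_right x p q
  have h2 := dist_triangle_right y p q
  simp only [gromovProduct]
  linarith

theorem gromovProduct_add (p x y : X) :
    gromovProduct p x y + gromovProduct x p y = dist p x := by
  simp only [gromovProduct, dist_comm y p, dist_comm y x, dist_comm x p]
  ring

/-- Two applications of the hyperbolic inequality. -/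
theorem IsHyperbolicSpace.min_three_le (hX : IsHyperbolicSpace δ X) {p x y z w : X} {A : ℝ}
    (h1 : A ≤ gromovProduct p x y) (h2 : A ≤ gromovProduct p y z)
    (h3 : A ≤ gromovProduct p z w) : A - 2 * δ ≤ gromovProduct p x w := by
  have hd := hX.nonneg p
  have h4 := hX p x y z
  have h5 := hX p x z w
  have h6 := le_min h1 h2
  have h7 : A - δ ≤ min (gromovProduct p x z) (gromovProduct p z w) :=
    le_min (by linarith) (by linarith)
  linarith

/-- Points `u` and `v` coarsely on geodesics from `p` to `x` and from `p` to `y`, at coarsely the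
same distance from `p` and before the geodesics diverge, are close to each other. -/
theorem IsHyperbolicSpace.dist_le_of_tripod (hX : IsHyperbolicSpace δ X) {p x y u v : X}
    {C e : ℝ} (hxy : dist p v - C ≤ gromovProduct p x y) (hu : gromovProduct u p x ≤ C)
    (hv : gromovProduct v p y ≤ C) (he : |dist p u - dist p v| ≤ e) :
    dist u v ≤ e + 2 * C + 4 * δ := by
  have h1 := gromovProduct_add p u x
  have h2 := gromovProduct_add p v y
  have h3 := hX.min_three_le (p := p) (x := u) (y := x) (z := y) (w := v)
    (A := min (dist p u) (dist p v) - C)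
    (by have := min_le_left (dist p u) (dist p v); linarith)
    (by have := min_le_right (dist p u) (dist p v); linarith)
    (by rw [gromovProduct_comm]; have := min_le_right (dist p u) (dist p v); linarith)
  have h4 := abs_le.1 he
  simp only [gromovProduct, dist_comm u p, dist_comm v p] at h3
  rcases min_choice (dist p u) (dist p v) with h | h <;> rw [h] at h3 <;> linarith [h4.1, h4.2]

/-- Moving the endpoints of a geodesic by distances that are small compared with the distance
to `z` moves its Gromov product at `z` by at most `2δ`. -/
theorem IsHyperbolicSpace.gromovProduct_le_of_far (hX : IsHyperbolicSpace δ X)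
    {z x y x' y' : X} {C : ℝ} (h : gromovProduct z x y ≤ C)
    (hx : C + 2 * δ + dist x x' < dist z x) (hy : C + 2 * δ + dist y y' < dist z y) :
    gromovProduct z x' y' ≤ C + 2 * δ := by
  by_contra! hc
  have h1 : ∀ a b : X, dist z a - dist a b ≤ gromovProduct z a b := by
    intro a b
    have := dist_triangle_left z b a
    have := dist_triangle z b a
    simp only [gromovProduct, dist_comm a z, dist_comm b z]
    linarith [dist_comm b a]
  have h2 := h1 x x'
  have h3 := h1 y y'
  rw [gromovProduct_comm] at h3
  set A := min (min (gromovProduct z x x') (gromovProduct z x' y')) (gromovProduct z y' y)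
  have h4 := hX.min_three_le (p := z) (A := A) (x := x) (y := x') (z := y') (w := y)
    ((min_le_left _ _).trans (min_le_left _ _)) ((min_le_left _ _).trans (min_le_right _ _))
    (min_le_right _ _)
  have h5 : C + 2 * δ < A := by
    refine lt_min (lt_min ?_ hc) ?_ <;> linarith
  linarith

end Hyperbolic

/-! ### Quasi-lines -/

/-- A coarse bi-infinite geodesic: a bi-infinite sequence of points whose steps are bounded by
`c`, whose distances are additive up to `c`, and grow at least linearly with slope `κ`. -/
structure IsQuasiLine {X : Type*} [MetricSpace X] (x : ℤ → X) (c κ : ℝ) : Prop where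
  pos : 0 < κ
  step : ∀ i, dist (x i) (x (i + 1)) ≤ c
  add : ∀ {i j k}, i ≤ j → j ≤ k → dist (x i) (x j) + dist (x j) (x k) ≤ dist (x i) (x k) + c
  lower : ∀ i j, κ * |((i - j : ℤ) : ℝ)| ≤ dist (x i) (x j)

namespace IsQuasiLine

variable {X : Type*} [MetricSpace X] {δ : ℝ} {x : ℤ → X} {c κ : ℝ}

theorem c_pos (hx : IsQuasiLine x c κ) : 0 < c := by
  have h1 := hx.step 0
  have h2 := hx.lower 0 (0 + 1)
  have := hx.pos
  norm_num at h2 h1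
  linarith

theorem upper (hx : IsQuasiLine x c κ) (i j : ℤ) :
    dist (x i) (x j) ≤ c * |((i - j : ℤ) : ℝ)| := by
  have key : ∀ (i : ℤ) (n : ℕ), dist (x i) (x (i + n)) ≤ c * n := by
    intro i n
    induction n with
    | zero => simp
    | succ n ih =>
      have h1 := hx.step (i + n)
      have h2 := dist_triangle (x i) (x (i + n)) (x (i + n + 1))
      push_cast
      rw [← add_assoc]
      linarith
  rcases le_total i j with h | h
  · obtain ⟨n, rfl⟩ := Int.le.dest h
    have := key i n
    simpa using this
  · obtain ⟨n, rfl⟩ := Int.le.dest h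
    have := key j n
    rw [dist_comm]
    simpa using this

theorem gromovProduct_le (hx : IsQuasiLine x c κ) {i j k : ℤ} (hij : i ≤ j) (hjk : j ≤ k) :
    gromovProduct (x j) (x i) (x k) ≤ c / 2 := by
  have := hx.add hij hjk
  simp only [gromovProduct]
  rw [dist_comm (x k) (x j)]
  linarith

theorem neg (hx : IsQuasiLine x c κ) : IsQuasiLine (fun i => x (-i)) c κ where
  pos := hx.pos
  step i := by
    have := hx.step (-(i + 1))
    rw [dist_comm]
    simpa using this
  add {i j k} hij hjk := by
    have := hx.add (neg_le_neg hjk) (neg_le_neg hij)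
    rw [dist_comm (x (-i)) (x (-j)), dist_comm (x (-j)) (x (-k)), dist_comm (x (-i)) (x (-k))]
    linarith
  lower i j := by
    have := hx.lower (-j) (-i)
    rw [dist_comm]
    convert this using 4
    ring

/-- Along a quasi-line, every distance from the initial point is attained up to `c`. -/
theorem exists_dist_between (hx : IsQuasiLine x c κ) {i k : ℤ} (hik : i ≤ k) (p : X) {T : ℝ}
    (h0 : dist p (x i) ≤ T) (h1 : T ≤ dist p (x k)) :
    ∃ j, i ≤ j ∧ j ≤ k ∧ dist p (x j) ≤ T ∧ T ≤ dist p (x j) + c := by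
  obtain ⟨n, rfl⟩ := Int.le.dest hik
  induction n with
  | zero => exact ⟨i, le_rfl, hik, h0, by simp at h1; linarith [hx.c_pos]⟩
  | succ n ih =>
    by_cases h : T ≤ dist p (x (i + n))
    · obtain ⟨j, hj⟩ := ih (by omega) h
      exact ⟨j, hj.1, by push_cast; omega, hj.2.2⟩
    · refine ⟨i + n, by omega, by push_cast; omega, (not_le.1 h).le, ?_⟩
      have h2 := hx.step (i + n)
      have h3 := dist_triangle p (x (i + n)) (x (i + n + 1))
      push_cast at h1
      rw [← add_assoc] at h1
      linarith

/-- A point with small Gromov product of two points of a quasi-line is close to the quasi-line. -/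
theorem exists_dist_le (hX : IsHyperbolicSpace δ X) (hx : IsQuasiLine x c κ) {i k : ℤ}
    (hik : i ≤ k) {z : X} {C : ℝ} (hz : gromovProduct z (x i) (x k) ≤ C) :
    ∃ j, dist z (x j) ≤ 2 * c + 2 * C + 4 * δ := by
  have hc := hx.c_pos
  have hd := hX.nonneg z
  have hC := (gromovProduct_nonneg z (x i) (x k)).trans hz
  rcases le_total (dist (x i) z) (dist (x i) (x k)) with h | h
  · obtain ⟨j, hij, hjk, h1, h2⟩ := hx.exists_dist_between hik (x i)
      (T := dist (x i) z) (by simp) h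
    refine ⟨j, ?_⟩
    have h3 := hx.gromovProduct_le hij hjk
    have h4 := hX.dist_le_of_tripod (p := x i) (x := x k) (y := x k) (u := z) (v := x j)
      (C := C + c / 2) (e := c) ?_ (by linarith) (by linarith) ?_
    · linarith
    · have : gromovProduct (x i) (x k) (x k) = dist (x i) (x k) := by
        simp [gromovProduct, dist_comm]
      rw [this]
      linarith
    · rw [abs_le]
      constructor <;> linarith
  · refine ⟨k, ?_⟩
    simp only [gromovProduct, dist_comm _ z] at hz
    rw [dist_comm (x i) z] at h
    linarith

end IsQuasiLine

/-! ### Elements with a quasi-axis -/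

section Stretched

variable {G : Type*} [Group G] {X : Type*} [MetricSpace X] [MulAction G X] {δ : ℝ}

/-- The point `s` is moved by `f ^ 2` noticeably further than by `f`. In a `δ`-hyperbolic space
this makes the orbit of `s` under the powers of `f` a quasi-line, with explicit constants. -/
def IsStretchedAt (δ : ℝ) (f : G) (s : X) : Prop :=
  dist s (f • s) + 3 * δ < dist s (f ^ 2 • s)

variable [IsIsometricSMul G X]

theorem gromovProduct_smul (g : G) (p x y : X) :
    gromovProduct (g • p) (g • x) (g • y) = gromovProduct p x y := by
  simp only [gromovProduct, dist_smul]

theorem dist_smul_left (g : G) (x y : X) : dist (g • x) y = dist x (g⁻¹ • y) := by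
  rw [← dist_smul g⁻¹, inv_smul_smul]

theorem dist_zpow_smul (f : G) (s : X) (i j : ℤ) :
    dist (f ^ i • s) (f ^ j • s) = dist s (f ^ (j - i) • s) := by
  rw [dist_smul_left, smul_smul, ← zpow_neg, ← zpow_add, neg_add_eq_sub]

theorem dist_zpow_neg_smul (f : G) (s : X) (i : ℤ) :
    dist s (f ^ (-i) • s) = dist s (f ^ i • s) := by
  rw [zpow_neg, dist_comm, dist_smul_left, inv_inv]

theorem dist_pow_smul_le (f : G) (s : X) (n : ℕ) : dist s (f ^ n • s) ≤ n * dist s (f • s) := by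
  induction n with
  | zero => simp
  | succ n ih =>
    have h1 := dist_triangle s (f ^ n • s) (f ^ (n + 1) • s)
    rw [pow_succ, mul_smul, dist_smul] at h1
    rw [pow_succ, mul_smul]
    push_cast
    linarith

theorem IsStretchedAt.conj {f : G} {s : X} (h : IsStretchedAt δ f s) (a : G) :
    IsStretchedAt δ (a * f * a⁻¹) (a • s) := by
  unfold IsStretchedAt at h ⊢
  rw [conj_pow, ← mul_smul, ← mul_smul, inv_mul_cancel_right, inv_mul_cancel_right, mul_smul,
    mul_smul, dist_smul, dist_smul]
  exact h

/-- By induction on `n` and the four-point inequality for `s`, `f • s`, `f ^ 2 • s` and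
`f ^ (n + 1) • s`, distances along the orbit grow at least linearly; the four-point inequality for
`s`, `f ^ i • s`, `f ^ (i + 1) • s` and `f ^ (i + j) • s` then shows that they are additive. -/
theorem IsStretchedAt.exists_isQuasiLine (hX : IsHyperbolicSpace δ X) {f : G} {s : X}
    (h : IsStretchedAt δ f s) :
    ∃ κ, IsQuasiLine (fun i : ℤ => f ^ i • s) (dist s (f • s) + 2 * δ) κ := by
  have hd := hX.nonneg s
  unfold IsStretchedAt at h
  set a : ℕ → ℝ := fun n => dist s (f ^ n • s) with ha
  have hdist : ∀ i j : ℕ, dist (f ^ i • s) (f ^ (i + j) • s) = a j := by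
    intro i j
    rw [pow_add, mul_smul, dist_smul]
  have ha0 : a 0 = 0 := by simp [ha]
  have ha1 : dist s (f • s) = a 1 := by simp [ha]
  have ha2 : dist s (f ^ 2 • s) = a 2 := rfl
  rw [ha1, ha2] at h
  rw [ha1]
  have h21 : a 2 ≤ 2 * a 1 := by
    have := dist_pow_smul_le f s 2
    rw [ha1] at this
    exact_mod_cast this
  set κ := a 2 - a 1 - 2 * δ with hκ
  have hκδ : δ < κ := by linarith
  have four : ∀ i j : ℕ, a (i + 1) + a (j + 1) ≤
      max (a i + a j) (a (i + (j + 1)) + a 1) + 2 * δ := by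
    intro i j
    have h1 := hX.four_point s (f ^ i • s) (f ^ (i + 1) • s) (f ^ (i + 1 + j) • s)
    have h2 := hdist i (j + 1)
    rw [show i + (j + 1) = i + 1 + j by ring] at h2 ⊢
    rw [hdist, hdist, h2] at h1
    exact h1
  have inc : ∀ n, a n + κ ≤ a (n + 1) := by
    intro n
    induction n with
    | zero => linarith [ha0]
    | succ n ih =>
      have h1 := four 1 n
      rw [show 1 + (n + 1) = n + 1 + 1 by ring] at h1
      norm_num at h1
      rcases le_max_iff.1 (sub_le_iff_le_add.2 h1) with h2 | h2 <;> linarith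
  have low : ∀ n : ℕ, κ * n ≤ a n := by
    intro n
    induction n with
    | zero => simp [ha0]
    | succ n ih => have := inc n; push_cast; linarith
  have add : ∀ i j : ℕ, a i + a j ≤ a (i + j) + (a 1 + 2 * δ) := by
    intro i j
    cases j with
    | zero =>
      have : 0 ≤ a 1 := dist_nonneg
      rw [ha0, add_zero, add_zero]
      linarith
    | succ j =>
      have h1 := four i j
      have h2 := inc i
      have h3 := inc j
      rcases le_max_iff.1 (sub_le_iff_le_add.2 h1) with h4 | h4 <;> linarith
  have hz : ∀ (i : ℤ) (n : ℕ), dist (f ^ i • s) (f ^ (i + n) • s) = a n := by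
    intro i n
    rw [dist_zpow_smul, add_sub_cancel_left, zpow_natCast]
  refine ⟨κ, by linarith, fun i => ?_, fun {i j k} hij hjk => ?_, fun i j => ?_⟩
  · have := hz i 1
    push_cast at this
    rw [this]
    linarith
  · obtain ⟨m, rfl⟩ := Int.le.dest hij
    obtain ⟨n, rfl⟩ := Int.le.dest hjk
    have h1 := hz i (m + n)
    push_cast at h1
    rw [← add_assoc] at h1
    simp only [hz, h1]
    exact add m n
  · rcases le_total i j with hij | hij
    · obtain ⟨m, rfl⟩ := Int.le.dest hij
      simp only [hz]
      simpa using low m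
    · obtain ⟨m, rfl⟩ := Int.le.dest hij
      rw [dist_comm]
      simp only [hz]
      simpa using low m

/-- Linear growth of one orbit of `f` implies linear growth of every orbit, with the same slope
and no additive constant: apply the bound to large powers. -/
theorem IsQuasiLine.le_dist_zpow_smul {f : G} {s : X} {c κ : ℝ}
    (hx : IsQuasiLine (fun i : ℤ => f ^ i • s) c κ) (x : X) (k : ℤ) :
    κ * |(k : ℝ)| ≤ dist x (f ^ k • x) := by
  have key : ∀ n : ℕ, n * (κ * |(k : ℝ)| - dist x (f ^ k • x)) ≤ 2 * dist x s := by
    intro n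
    have h1 := hx.lower 0 (k * n)
    have h2 := dist_pow_smul_le (f ^ k) x n
    have h3 := dist_triangle4 s x (f ^ (k * n) • x) (f ^ (k * n) • s)
    rw [dist_smul, dist_comm s x] at h3
    rw [← zpow_natCast, ← zpow_mul] at h2
    simp only [zpow_zero, one_smul, zero_sub, Int.cast_neg, abs_neg, Int.cast_mul,
      Int.cast_natCast, abs_mul, Nat.abs_cast] at h1
    nlinarith
  by_contra! hlt
  obtain ⟨n, hn⟩ := exists_nat_gt (2 * dist x s / (κ * |(k : ℝ)| - dist x (f ^ k • x)))
  rw [div_lt_iff₀ (by linarith)] at hn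
  linarith [key n]

theorem isLoxodromic_of_le_dist {f : G} {s : X} {κ : ℝ} (hκ : 0 < κ)
    (h : ∀ k : ℤ, κ * |(k : ℝ)| ≤ dist s (f ^ k • s)) : IsLoxodromic X f := by
  have up : ∀ k : ℤ, dist s (f ^ k • s) ≤ dist s (f • s) * |(k : ℝ)| := by
    intro k
    obtain ⟨n, rfl | rfl⟩ := k.eq_nat_or_neg
    · have := dist_pow_smul_le f s n
      simp only [zpow_natCast, Int.cast_natCast, Nat.abs_cast]
      linarith
    · have := dist_pow_smul_le f s n
      rw [dist_zpow_neg_smul]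
      simp only [zpow_natCast, Int.cast_neg, Int.cast_natCast, abs_neg, Nat.abs_cast]
      linarith
  refine ⟨s, max (max 1 (dist s (f • s))) κ⁻¹, 0, ?_, le_rfl, fun y z => ?_⟩
  · exact (le_max_left _ _).trans (le_max_left _ _)
  · have hdist : dist y z = |((z - y : ℤ) : ℝ)| := by
      rw [dist_comm, Int.dist_eq]
      push_cast
      rfl
    have h0 : 0 ≤ dist y z := dist_nonneg
    rw [dist_zpow_smul, sub_zero, add_zero, hdist]
    rw [hdist] at h0
    constructor
    · refine le_trans ?_ (h (z - y))
      rw [div_le_iff₀ (by positivity), mul_right_comm]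
      refine le_mul_of_one_le_left h0 ?_
      calc (1 : ℝ) = κ * κ⁻¹ := (mul_inv_cancel₀ hκ.ne').symm
        _ ≤ _ := by gcongr; exact le_max_right _ _
    · refine (up _).trans ?_
      gcongr
      exact (le_max_right _ _).trans (le_max_left _ _)

theorem IsQuasiLine.isLoxodromic_pow {f : G} {s : X} {c κ : ℝ}
    (hx : IsQuasiLine (fun i : ℤ => f ^ i • s) c κ) {N : ℕ} (hN : 0 < N) :
    IsLoxodromic X (f ^ N) := by
  have hN' : (0 : ℝ) < N := by exact_mod_cast hN
  refine isLoxodromic_of_le_dist (s := s) (κ := κ * N) (mul_pos hx.pos hN') fun k => ?_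
  have := hx.le_dist_zpow_smul s (N * k)
  rw [zpow_mul, zpow_natCast] at this
  push_cast at this
  rw [abs_mul, Nat.abs_cast] at this
  linarith

theorem IsQuasiLine.not_isElliptic {f : G} {s : X} {c κ : ℝ}
    (hx : IsQuasiLine (fun i : ℤ => f ^ i • s) c κ) : ¬ IsElliptic X f := by
  rintro ⟨y, hy⟩
  obtain ⟨C, hC⟩ := (Metric.isBounded_iff_subset_closedBall y).1 hy
  obtain ⟨n, hn⟩ := exists_nat_gt (C / κ)
  rw [div_lt_iff₀ hx.pos] at hn
  have h1 := hC ⟨n, rfl⟩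
  have h2 := hx.le_dist_zpow_smul y n
  rw [Metric.mem_closedBall, dist_comm] at h1
  simp only [Int.cast_natCast, Nat.abs_cast] at h2
  simp only at h1
  linarith

end Stretched

/-! ### Elementary closures -/

section ElementaryClosure

variable {G : Type*} [Group G]

/-- The elements that conjugate some positive power of `f` to itself or to its inverse. If `f` is
loxodromic for an acylindrical action, these are the elements that coarsely preserve the
quasi-axis of `f`, and they form the largest virtually cyclic subgroup that contains `f`. -/
def elementaryClosure (f : G) : Subgroup G where
  carrier := {t | ∃ n : ℕ, 0 < n ∧ (t * f ^ n * t⁻¹ = f ^ n ∨ t * f ^ n * t⁻¹ = (f ^ n)⁻¹)}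
  one_mem' := ⟨1, one_pos, by simp⟩
  inv_mem' := by
    rintro t ⟨n, hn, h | h⟩
    · refine ⟨n, hn, Or.inl ?_⟩
      nth_rewrite 1 [← h]
      group
    · refine ⟨n, hn, Or.inr ?_⟩
      have h' := congrArg (fun g => t⁻¹ * g⁻¹ * t) h
      simpa [mul_assoc] using h'.symm
  mul_mem' := by
    rintro t u ⟨n, hn, ht⟩ ⟨m, hm, hu⟩
    have ht' : t * f ^ (n * m) * t⁻¹ = f ^ (n * m) ∨ t * f ^ (n * m) * t⁻¹ = (f ^ (n * m))⁻¹ := by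
      rw [pow_mul, ← conj_pow, ← inv_pow]
      rcases ht with h | h <;> simp [h]
    have hu' : u * f ^ (n * m) * u⁻¹ = f ^ (n * m) ∨ u * f ^ (n * m) * u⁻¹ = (f ^ (n * m))⁻¹ := by
      rw [mul_comm n, pow_mul, ← conj_pow, ← inv_pow]
      rcases hu with h | h <;> simp [h]
    refine ⟨n * m, Nat.mul_pos hn hm, ?_⟩
    have e : t * u * f ^ (n * m) * (t * u)⁻¹ = t * (u * f ^ (n * m) * u⁻¹) * t⁻¹ := by group
    rw [e]
    rcases hu' with h | h <;> rw [h]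
    · exact ht'
    · rw [← conj_inv]
      rcases ht' with h | h <;> simp [h]

theorem mem_elementaryClosure {f t : G} : t ∈ elementaryClosure f ↔
    ∃ n : ℕ, 0 < n ∧ (t * f ^ n * t⁻¹ = f ^ n ∨ t * f ^ n * t⁻¹ = (f ^ n)⁻¹) := Iff.rfl

theorem zpow_mem_elementaryClosure (f : G) (n : ℤ) : f ^ n ∈ elementaryClosure f :=
  zpow_mem (mem_elementaryClosure.2 ⟨1, one_pos, by simp⟩) n

theorem mem_elementaryClosure_conj {f a t : G} :
    t ∈ elementaryClosure (a * f * a⁻¹) ↔ a⁻¹ * t * a ∈ elementaryClosure f := by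
  simp only [mem_elementaryClosure, conj_pow]
  refine exists_congr fun n => and_congr_right fun _ => or_congr ?_ ?_
  · constructor <;> intro h
    · have := congrArg (fun g => a⁻¹ * g * a) h
      simpa [mul_assoc] using this
    · have := congrArg (fun g => a * g * a⁻¹) h
      simpa [mul_assoc] using this
  · constructor <;> intro h
    · have := congrArg (fun g => a⁻¹ * g * a) h
      simpa [mul_assoc] using this
    · have := congrArg (fun g => a * g * a⁻¹) h
      simpa [mul_assoc] using this

end ElementaryClosure

/-! ### Fellow travelling of translated quasi-axes -/

section FellowTravel

theorem exists_lt_eq_of_encard_le {α : Type*} {S : Set α} {N : ℕ} (hS : S.encard ≤ N)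
    {g : ℕ → α} (hg : ∀ i ≤ N, g i ∈ S) : ∃ i j, i < j ∧ j ≤ N ∧ g i = g j := by
  have hfin : S.Finite := finite_of_encard_le_coe hS
  have hcard : hfin.toFinset.card ≤ N := by
    rw [hfin.encard_eq_coe_toFinset_card] at hS
    exact_mod_cast hS
  obtain ⟨i, hi, j, hj, hij, h⟩ := Finset.exists_ne_map_eq_of_card_lt_of_maps_to
    (s := Finset.range (N + 1)) (t := hfin.toFinset) (f := g) (by simp; omega)
    (fun i hi => by
      simp only [Finset.coe_range, mem_Iio] at hi
      simpa using hg i (by omega))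
  simp only [Finset.mem_range] at hi hj
  rcases lt_or_gt_of_ne hij with h' | h'
  · exact ⟨i, j, h', by omega, h⟩
  · exact ⟨j, i, h', by omega, h.symm⟩

variable {G : Type*} [Group G] {X : Type*} [MetricSpace X] [MulAction G X] [IsIsometricSMul G X]
  {δ : ℝ}

/-- If `h` moves a long piece of the quasi-axis of `f` close to a piece of the quasi-axis of `f'`
(here `f'` is `f` or `f⁻¹`), then every `h * f ^ i * h⁻¹ * (f' ^ i)⁻¹` moves two distant points by a
bounded amount; by acylindricity two of these elements agree. -/
theorem IsAcylindrical.exists_conj_pow_eq (hX : IsHyperbolicSpace δ X) (hA : IsAcylindrical G X)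
    {f f' : G} {s : X} {c κ : ℝ} (hx : IsQuasiLine (fun i : ℤ => f ^ i • s) c κ)
    (hy : IsQuasiLine (fun i : ℤ => f' ^ i • s) c κ)
    (hff' : ∀ n : ℕ, dist s (f' ^ n • s) = dist s (f ^ n • s)) (D : ℝ) :
    ∃ R m : ℕ, 0 < m ∧ ∀ (h : G) (j l : ℕ), R ≤ j → dist (h • s) s ≤ D →
      dist (h • f ^ j • s) (f' ^ l • s) ≤ D → h * f ^ m * h⁻¹ = f' ^ m := by
  have hd := hX.nonneg s
  have hc := hx.c_pos
  have hκ := hx.pos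
  set D₁ := 3 * D + 2 * c + 4 * δ with hD₁
  obtain ⟨M, N, hM, hMN⟩ := hA (2 * |D₁| + 1) (by positivity)
  set R₁ : ℕ := N + ⌈M / κ⌉₊ with hR₁
  have hR₁M : M ≤ κ * (R₁ - N) := by
    have := Nat.le_ceil (M / κ)
    rw [div_le_iff₀ hκ] at this
    rw [hR₁]
    push_cast
    linarith
  refine ⟨max R₁ ⌈(c * R₁ + 2 * D) / κ⌉₊, N.factorial, N.factorial_pos, ?_⟩
  intro h j l hj hs hjl
  have hD : 0 ≤ D := dist_nonneg.trans hs
  have hD₁0 : 0 ≤ D₁ := by positivity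
  have hj₁ : R₁ ≤ j := (le_max_left _ _).trans hj
  have hjc : c * R₁ + 2 * D ≤ κ * j := by
    have h1 := Nat.le_ceil ((c * R₁ + 2 * D) / κ)
    have h2 : (⌈(c * R₁ + 2 * D) / κ⌉₊ : ℝ) ≤ j := by exact_mod_cast (le_max_right _ _).trans hj
    rw [div_le_iff₀ hκ] at h1
    nlinarith
  have haj : κ * j ≤ dist s (f ^ j • s) := by simpa using hx.lower 0 j
  have hal : dist s (f' ^ l • s) ≤ c * l := by simpa using hy.upper 0 l
  have hajl : dist s (f ^ j • s) ≤ dist s (f' ^ l • s) + 2 * D := by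
    have h1 := dist_triangle4 (h • s) s (f' ^ l • s) (h • f ^ j • s)
    rw [dist_smul] at h1
    rw [dist_comm] at hjl
    linarith
  have hl₁ : R₁ ≤ l := by
    have : c * R₁ ≤ c * l := by linarith
    exact_mod_cast le_of_mul_le_mul_left this hc
  have key : ∀ r ≤ R₁, dist (h • f ^ r • s) (f' ^ r • s) ≤ D₁ := by
    intro r hr
    have e1 : dist s (f' ^ r • s) = dist (h • s) (h • f ^ r • s) := by rw [dist_smul, hff']
    have h1 := hX.dist_le_of_tripod (p := s) (x := h • f ^ j • s) (y := f' ^ l • s)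
      (u := h • f ^ r • s) (v := f' ^ r • s) (C := c + D) (e := D) ?_ ?_ ?_ ?_
    · linarith
    · have h1 := gromovProduct_le_add_dist s (f' ^ l • s) (f' ^ l • s) (h • f ^ j • s)
      have h2 : gromovProduct s (f' ^ l • s) (f' ^ l • s) = dist s (f' ^ l • s) := by
        simp [gromovProduct, dist_comm]
      have h3 := hy.add (i := 0) (j := r) (k := l) (by omega) (by omega)
      have h4 : 0 ≤ dist (f' ^ (r : ℤ) • s) (f' ^ (l : ℤ) • s) := dist_nonneg
      simp only [zpow_zero, one_smul, zpow_natCast] at h3 h4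
      rw [h2] at h1
      rw [gromovProduct_comm]
      rw [dist_comm] at hjl
      linarith
    · have h1 := gromovProduct_le_add_dist (h • f ^ r • s) (h • f ^ j • s) s (h • s)
      have h2 := hx.gromovProduct_le (i := 0) (j := r) (k := j) (by omega) (by omega)
      simp only [zpow_zero, one_smul, zpow_natCast] at h2
      rw [← gromovProduct_smul h, gromovProduct_comm] at h2
      rw [gromovProduct_comm]
      rw [dist_comm] at hs
      linarith
    · have h2 := hy.gromovProduct_le (i := 0) (j := r) (k := l) (by omega) (by omega)
      simp only [zpow_zero, one_smul, zpow_natCast] at h2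
      linarith
    · rw [e1]
      refine (abs_dist_sub_le _ _ _).trans ?_
      rwa [dist_comm]
  have move : ∀ r ≤ R₁, ∀ i ≤ N, i ≤ r →
      dist (f' ^ r • s) ((h * f ^ i * h⁻¹ * (f' ^ i)⁻¹) • f' ^ r • s) ≤ 2 * |D₁| + 1 := by
    intro r hr i _ hir
    obtain ⟨n, rfl⟩ := Nat.exists_eq_add_of_le hir
    have h1 := key (i + n) hr
    have h2 := key n (by omega)
    have e : (h * f ^ i * h⁻¹ * (f' ^ i)⁻¹) • f' ^ (i + n) • s = h • f ^ i • h⁻¹ • f' ^ n • s := by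
      simp only [pow_add, mul_smul, inv_smul_smul]
    have e2 : dist (h • f ^ (i + n) • s) (h • f ^ i • h⁻¹ • f' ^ n • s) =
        dist (h • f ^ n • s) (f' ^ n • s) := by
      rw [dist_smul, pow_add, mul_smul, dist_smul, ← dist_smul_left]
    have h3 := dist_triangle_left (f' ^ (i + n) • s) (h • f ^ i • h⁻¹ • f' ^ n • s)
      (h • f ^ (i + n) • s)
    rw [e, abs_of_nonneg hD₁0]
    linarith
  have hfar : M ≤ dist (f' ^ N • s) (f' ^ R₁ • s) := by
    have h1 := hy.lower R₁ N
    have h2 : (N : ℝ) ≤ R₁ := by rw [hR₁]; push_cast; linarith [Nat.cast_nonneg (α := ℝ) ⌈M / κ⌉₊]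
    simp only [zpow_natCast, Int.cast_sub, Int.cast_natCast, abs_of_nonneg (sub_nonneg.2 h2)] at h1
    rw [dist_comm] at h1
    linarith
  obtain ⟨i, j, hij, hjN, he⟩ := exists_lt_eq_of_encard_le (hMN _ _ hfar)
    (g := fun i => h * f ^ i * h⁻¹ * (f' ^ i)⁻¹)
    (fun i hi => ⟨move N (by omega) i hi hi, move R₁ le_rfl i hi (by omega)⟩)
  obtain ⟨n, rfl⟩ := Nat.exists_eq_add_of_le hij.le
  have hn : h * f ^ n * h⁻¹ = f' ^ n := by
    rw [pow_add, pow_add, mul_inv_rev] at he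
    have h1 := congrArg (fun t => h * (f ^ i)⁻¹ * h⁻¹ * t * f' ^ i * f' ^ n) he
    simp only [mul_assoc, inv_mul_cancel_left, inv_mul_cancel, mul_one, mul_inv_cancel_left] at h1
    rw [mul_assoc, ← h1, one_mul]
  obtain ⟨q, hq⟩ := Nat.dvd_factorial (by omega : 0 < n) (by omega : n ≤ N)
  rw [hq, pow_mul, pow_mul, ← conj_pow, hn]

end FellowTravel

namespace IsQuasiLine

variable {X : Type*} [MetricSpace X] {δ : ℝ} {x : ℤ → X} {c κ : ℝ}

/-- The variant of `exists_dist_between` in which the two indices come in any order. -/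
theorem exists_dist_between' (hx : IsQuasiLine x c κ) (i k : ℤ) (p : X) {T : ℝ}
    (h0 : dist p (x i) ≤ T) (h1 : T ≤ dist p (x k)) :
    ∃ j, gromovProduct (x j) (x i) (x k) ≤ c / 2 ∧ dist p (x j) ≤ T ∧ T ≤ dist p (x j) + c := by
  rcases le_total i k with h | h
  · obtain ⟨j, hij, hjk, hj⟩ := hx.exists_dist_between h p h0 h1
    exact ⟨j, hx.gromovProduct_le hij hjk, hj⟩
  · obtain ⟨j, hij, hjk, hj⟩ := hx.neg.exists_dist_between (neg_le_neg h) p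
      (by simpa using h0) (by simpa using h1)
    refine ⟨-j, ?_, hj⟩
    have := hx.neg.gromovProduct_le hij hjk
    simpa using this

theorem min_dist_le_gromovProduct (hx : IsQuasiLine x c κ) {j k : ℤ} (hj : 0 ≤ j) (hk : 0 ≤ k) :
    min (dist (x 0) (x j)) (dist (x 0) (x k)) - c / 2 ≤ gromovProduct (x 0) (x j) (x k) := by
  simp only [gromovProduct, dist_comm _ (x 0)]
  rcases le_total j k with h | h
  · have := hx.add hj h
    have := min_le_left (dist (x 0) (x j)) (dist (x 0) (x k))
    linarith
  · have := hx.add hk h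
    have := min_le_right (dist (x 0) (x j)) (dist (x 0) (x k))
    rw [dist_comm (x j)]
    linarith

end IsQuasiLine

/-! ### Elementary closures of elements with a quasi-axis -/

section Axis

variable {G : Type*} [Group G] {X : Type*} [MetricSpace X] [MulAction G X] {δ : ℝ} {f : G} {s : X}
  {c κ : ℝ}

theorem IsQuasiLine.inv (hx : IsQuasiLine (fun i : ℤ => f ^ i • s) c κ) :
    IsQuasiLine (fun i : ℤ => f⁻¹ ^ i • s) c κ := by
  simpa only [inv_zpow'] using hx.neg

variable [IsIsometricSMul G X]

theorem IsAcylindrical.exists_conj_pow_eq_self (hX : IsHyperbolicSpace δ X)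
    (hA : IsAcylindrical G X) (hx : IsQuasiLine (fun i : ℤ => f ^ i • s) c κ) (D : ℝ) :
    ∃ R m : ℕ, 0 < m ∧ ∀ h : G, dist (h • s) s ≤ D → dist (h • f ^ R • s) (f ^ R • s) ≤ D →
      h * f ^ m * h⁻¹ = f ^ m := by
  obtain ⟨R, m, hm, h⟩ := hA.exists_conj_pow_eq hX hx hx (fun _ => rfl) D
  exact ⟨R, m, hm, fun g => h g R R le_rfl⟩

/-- An element that moves two distant points of the quasi-axis of `f` close to the quasi-axis
belongs to the elementary closure of `f`. -/
theorem IsAcylindrical.exists_mem_elementaryClosure (hX : IsHyperbolicSpace δ X)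
    (hA : IsAcylindrical G X) (hx : IsQuasiLine (fun i : ℤ => f ^ i • s) c κ) (D : ℝ) :
    ∃ R : ℕ, ∀ (h : G) (i j k l : ℤ), R ≤ |i - j| → dist (h • f ^ i • s) (f ^ k • s) ≤ D →
      dist (h • f ^ j • s) (f ^ l • s) ≤ D → h ∈ elementaryClosure f := by
  obtain ⟨R₁, m₁, hm₁, h₁⟩ := hA.exists_conj_pow_eq hX hx hx (fun _ => rfl) D
  obtain ⟨R₂, m₂, hm₂, h₂⟩ := hA.exists_conj_pow_eq hX hx hx.inv (fun n => by
    have := dist_zpow_neg_smul f s n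
    simpa using this) D
  have main : ∀ (h : G) (i j k l : ℤ), (max R₁ R₂ : ℕ) ≤ j - i →
      dist (h • f ^ i • s) (f ^ k • s) ≤ D → dist (h • f ^ j • s) (f ^ l • s) ≤ D →
      h ∈ elementaryClosure f := by
    intro h i j k l hR hi hj
    obtain ⟨n, hn⟩ := Int.le.dest (show i ≤ j by omega)
    have e1 : dist ((f ^ (-k) * h * f ^ i) • s) s ≤ D := by
      rw [mul_smul, mul_smul, dist_smul_left, zpow_neg, inv_inv]
      exact hi
    have e2 : ∀ t : X, dist ((f ^ (-k) * h * f ^ i) • f ^ n • s) t =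
        dist (h • f ^ j • s) (f ^ k • t) := by
      intro t
      rw [mul_smul, mul_smul, dist_smul_left, zpow_neg, inv_inv, ← hn, zpow_add, zpow_natCast,
        mul_smul]
    have hmem : f ^ (-k) * h * f ^ i ∈ elementaryClosure f := by
      rw [mem_elementaryClosure]
      rcases le_total k l with hkl | hkl
      · obtain ⟨q, rfl⟩ := Int.le.dest hkl
        refine ⟨m₁, hm₁, Or.inl (h₁ _ n q (by omega) e1 ?_)⟩
        rw [e2, ← zpow_natCast, ← mul_smul (f ^ k), ← zpow_add]
        exact hj
      · obtain ⟨q, rfl⟩ := Int.le.dest hkl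
        refine ⟨m₂, hm₂, Or.inr ?_⟩
        rw [← inv_pow]
        refine h₂ _ n q (by omega) e1 ?_
        rw [e2, inv_pow, ← zpow_natCast, ← zpow_neg, ← mul_smul (f ^ (l + (q : ℤ))),
          ← zpow_add, add_neg_cancel_right]
        exact hj
    have := mul_mem (mul_mem (zpow_mem_elementaryClosure f k) hmem)
      (zpow_mem_elementaryClosure f (-i))
    convert this using 1
    simp only [zpow_neg]
    group
  refine ⟨max R₁ R₂, fun h i j k l hR hi hj => ?_⟩
  rcases le_abs'.1 hR with h' | h'
  · exact main h i j k l (by omega) hi hj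
  · exact main h j i l k (by omega) hj hi

/-- The elementary closure of `f` coarsely preserves the quasi-axis of `f`, with a constant that
does not depend on the element: only far away endpoints are moved by an uncontrolled amount. -/
theorem IsQuasiLine.exists_dist_le_of_mem_elementaryClosure (hX : IsHyperbolicSpace δ X)
    (hx : IsQuasiLine (fun i : ℤ => f ^ i • s) c κ) {t : G} (ht : t ∈ elementaryClosure f) (i : ℤ) :
    ∃ j : ℤ, dist (t • f ^ i • s) (f ^ j • s) ≤ 3 * c + 8 * δ := by
  obtain ⟨n, hn, hpm⟩ := ht
  have hκ := hx.pos
  set e := dist (t • s) s with he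
  obtain ⟨K, hK⟩ := exists_nat_gt ((c / 2 + 2 * δ + e) / κ + |(i : ℝ)|)
  have hKn : (K : ℝ) ≤ (n * K : ℕ) := by
    have : K ≤ n * K := Nat.le_mul_of_pos_left K hn
    exact_mod_cast this
  set m : ℕ := n * K with hm
  have hmi := neg_abs_le (i : ℝ)
  have hmi' := le_abs_self (i : ℝ)
  have hpos : 0 ≤ (c / 2 + 2 * δ + e) / κ := by
    have := hx.c_pos
    have := hX.nonneg s
    positivity
  have hdiv : ∀ r : ℝ, (c / 2 + 2 * δ + e) / κ < r → c / 2 + 2 * δ + e < κ * r := by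
    intro r hr
    rwa [div_lt_iff₀' hκ] at hr
  have hle1 : -(m : ℤ) ≤ i := by
    have : -(m : ℝ) ≤ i := by linarith
    exact_mod_cast this
  have hle2 : i ≤ (m : ℤ) := by
    have : (i : ℝ) ≤ m := by linarith
    exact_mod_cast this
  have hg := hx.gromovProduct_le hle1 hle2
  rw [← gromovProduct_smul t] at hg
  have far1 : c / 2 + 2 * δ + e < dist (t • f ^ i • s) (t • f ^ (-(m : ℤ)) • s) := by
    rw [dist_smul]
    refine (hdiv (i + m) (by linarith)).trans_le ?_
    have h2 := hx.lower i (-m)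
    push_cast at h2
    rw [sub_neg_eq_add] at h2
    exact (mul_le_mul_of_nonneg_left (le_abs_self _) hκ.le).trans h2
  have far2 : c / 2 + 2 * δ + e < dist (t • f ^ i • s) (t • f ^ (m : ℤ) • s) := by
    rw [dist_smul]
    refine (hdiv (m - i) (by linarith)).trans_le ?_
    have h2 := hx.lower i m
    push_cast at h2
    rw [abs_sub_comm] at h2
    exact (mul_le_mul_of_nonneg_left (le_abs_self _) hκ.le).trans h2
  have fin : ∀ r : ℤ, t * f ^ (m : ℤ) * t⁻¹ = f ^ r →
      dist (t • f ^ (m : ℤ) • s) (f ^ r • s) = e ∧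
        dist (t • f ^ (-(m : ℤ)) • s) (f ^ (-r) • s) = e := by
    intro r hr
    have hr' : t * f ^ (-(m : ℤ)) * t⁻¹ = f ^ (-r) := by
      rw [zpow_neg, zpow_neg, ← hr, conj_inv]
    refine ⟨?_, ?_⟩
    · rw [← hr, smul_smul, mul_smul _ t⁻¹, dist_smul, ← dist_smul_left]
    · rw [← hr', smul_smul, mul_smul _ t⁻¹, dist_smul, ← dist_smul_left]
  have hor : t * f ^ (m : ℤ) * t⁻¹ = f ^ (m : ℤ) ∨ t * f ^ (m : ℤ) * t⁻¹ = f ^ (-(m : ℤ)) := by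
    rw [zpow_neg, zpow_natCast, hm, pow_mul, ← conj_pow, ← inv_pow]
    rcases hpm with h | h <;> simp [h]
  rcases hor with h | h
  · obtain ⟨d1, d2⟩ := fin _ h
    have h1 := hX.gromovProduct_le_of_far hg (by rw [d2]; exact far1) (by rw [d1]; exact far2)
    obtain ⟨j, hj⟩ := hx.exists_dist_le hX (hle1.trans hle2) h1
    exact ⟨j, hj.trans (by linarith)⟩
  · obtain ⟨d1, d2⟩ := fin _ h
    rw [neg_neg] at d2
    have h1 := hX.gromovProduct_le_of_far hg (by rw [d2]; exact far1) (by rw [d1]; exact far2)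
    rw [gromovProduct_comm] at h1
    obtain ⟨j, hj⟩ := hx.exists_dist_le hX (hle1.trans hle2) h1
    exact ⟨j, hj.trans (by linarith)⟩

/-- Translates of the quasi-axis of `f` by elements outside of the elementary closure of `f` have
bounded projection to the quasi-axis, uniformly as long as the base point moves by at most `D`. -/
theorem IsAcylindrical.exists_gromovProduct_le (hX : IsHyperbolicSpace δ X)
    (hA : IsAcylindrical G X) (hx : IsQuasiLine (fun i : ℤ => f ^ i • s) c κ) (D : ℝ) :
    ∃ C, ∀ h ∉ elementaryClosure f, dist s (h • s) ≤ D → ∀ n k : ℤ,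
      gromovProduct s (h • f ^ n • s) (f ^ k • s) ≤ C := by
  have hc := hx.c_pos
  have hd := hX.nonneg s
  obtain ⟨R, hR⟩ := hA.exists_mem_elementaryClosure hX hx (2 * c + 2 * D + 4 * δ)
  refine ⟨c * R + D + c, fun h hh hs n k => ?_⟩
  have hD : 0 ≤ D := dist_nonneg.trans hs
  by_contra! hlt
  set T := c * R + D + c with hT
  have hR0 : (0 : ℝ) ≤ c * R := by positivity
  have hy := gromovProduct_add s (h • f ^ n • s) (f ^ k • s)
  have hy' := gromovProduct_nonneg (h • f ^ n • s) s (f ^ k • s)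
  have hk := gromovProduct_add s (f ^ k • s) (h • f ^ n • s)
  have hk' := gromovProduct_nonneg (f ^ k • s) s (h • f ^ n • s)
  rw [gromovProduct_comm s] at hk
  obtain ⟨i, hi1, hi2, hi3⟩ := hx.exists_dist_between' 0 k s (T := T) (by simp; linarith)
    (by linarith)
  have hxh : IsQuasiLine (fun i : ℤ => h • f ^ i • s) c κ :=
    ⟨hx.pos, fun i => by simpa only [dist_smul] using hx.step i,
      fun h1 h2 => by simpa only [dist_smul] using hx.add h1 h2,
      fun i j => by simpa only [dist_smul] using hx.lower i j⟩
  obtain ⟨j, hj1, hj2, hj3⟩ := hxh.exists_dist_between' 0 n s (T := T) (by simp; linarith)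
    (by linarith)
  simp only [zpow_zero, one_smul] at hi1 hi2 hi3 hj1 hj2 hj3
  have h1 := hX.dist_le_of_tripod (p := s) (x := h • f ^ n • s) (y := f ^ k • s)
    (u := h • f ^ j • s) (v := f ^ i • s) (C := c / 2 + D) (e := c) (by linarith) ?_
    (by linarith) ?_
  · refine hh (hR h 0 j 0 i ?_ ?_ (h1.trans (by linarith)))
    · have h2 := hx.upper 0 j
      have h3 := dist_triangle s (h • s) (h • f ^ j • s)
      simp only [zpow_zero, one_smul] at h2
      rw [dist_smul] at h3
      have h4 : c * R ≤ c * |((0 - j : ℤ) : ℝ)| := by linarith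
      have h5 := le_of_mul_le_mul_left h4 hc
      exact_mod_cast h5
    · simp only [zpow_zero, one_smul]
      rw [dist_comm]
      linarith
  · have h2 := gromovProduct_le_add_dist (h • f ^ j • s) (h • f ^ n • s) s (h • s)
    rw [gromovProduct_comm, gromovProduct_comm _ (h • f ^ n • s) (h • s)] at h2
    linarith
  · rw [abs_le]
    constructor <;> linarith

/-- If the quasi-axis of `f` and its translate by `a` diverge, then only finitely many elements
coarsely preserve both: such an element moves `s` by a bounded amount. -/
theorem IsAcylindrical.finite_inter_elementaryClosure (hX : IsHyperbolicSpace δ X)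
    (hA : IsAcylindrical G X) (hx : IsQuasiLine (fun i : ℤ => f ^ i • s) c κ) {a : G}
    (ha : a ∉ elementaryClosure f) :
    {t : G | t ∈ elementaryClosure f ∧ a⁻¹ * t * a ∈ elementaryClosure f}.Finite := by
  have hc := hx.c_pos
  have hκ := hx.pos
  have hd := hX.nonneg s
  set c₀ := 3 * c + 8 * δ with hc₀
  obtain ⟨C, hC⟩ := hA.exists_gromovProduct_le hX hx (dist s (a • s))
  set B := 2 * C + 3 * c₀ + dist s (a • s) with hB
  have hCa := hC a ha le_rfl
  have hC0 : 0 ≤ C := (gromovProduct_nonneg _ _ _).trans (hCa 0 0)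
  have hB0 : 0 ≤ B := by positivity
  have hmove : ∀ t, t ∈ elementaryClosure f → a⁻¹ * t * a ∈ elementaryClosure f →
      dist s (t • s) ≤ B := by
    intro t h1 h2
    obtain ⟨j, hj⟩ := hx.exists_dist_le_of_mem_elementaryClosure hX h1 0
    obtain ⟨l, hl⟩ := hx.exists_dist_le_of_mem_elementaryClosure hX h2 0
    rw [zpow_zero, one_smul] at hj hl
    rw [mul_smul, mul_smul, dist_smul_left, inv_inv] at hl
    have h3 := hCa l j
    simp only [gromovProduct] at h3
    have h4 := dist_triangle4 (a • f ^ l • s) (t • a • s) (t • s) (f ^ j • s)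
    rw [dist_smul, dist_comm _ (t • a • s), dist_comm (a • s) s] at h4
    have h5 := dist_triangle_right s (t • s) (f ^ j • s)
    rw [dist_comm (f ^ j • s) s] at h3
    have h6 : 0 ≤ dist (a • f ^ l • s) s := dist_nonneg
    linarith
  obtain ⟨M, N, hM, hMN⟩ := hA (2 * (B + c₀) + 1) (by positivity)
  obtain ⟨m, hm⟩ := exists_nat_ge (M / κ)
  rw [div_le_iff₀' hκ] at hm
  have hfar : M ≤ dist s (f ^ m • s) := by
    have := hx.lower 0 m
    simp only [zpow_zero, one_smul, zpow_natCast] at this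
    simp at this
    linarith
  obtain ⟨J, hJ⟩ := exists_nat_ge ((B + c * m + c₀) / κ)
  rw [div_le_iff₀' hκ] at hJ
  refine Set.Finite.subset (s := ⋃ j ∈ Finset.Icc (-(J : ℤ)) J,
    {t : G | dist s (t • s) ≤ B ∧ dist (t • f ^ m • s) (f ^ j • s) ≤ c₀})
    (Set.Finite.biUnion (Finset.finite_toSet _) fun j _ => ?_) ?_
  · rcases Set.eq_empty_or_nonempty
      {t : G | dist s (t • s) ≤ B ∧ dist (t • f ^ m • s) (f ^ j • s) ≤ c₀} with h | ⟨t₀, h1, h2⟩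
    · rw [h]
      exact Set.finite_empty
    · refine Set.Finite.subset ((finite_of_encard_le_coe (hMN _ _ hfar)).image (t₀ * ·)) ?_
      rintro t ⟨h3, h4⟩
      refine ⟨t₀⁻¹ * t, ⟨?_, ?_⟩, mul_inv_cancel_left _ _⟩
      · rw [mul_smul, ← dist_smul_left]
        have := dist_triangle_left (t₀ • s) (t • s) s
        linarith
      · rw [mul_smul, ← dist_smul_left]
        have := dist_triangle_right (t₀ • f ^ m • s) (t • f ^ m • s) (f ^ j • s)
        linarith
  · rintro t ⟨h1, h2⟩
    obtain ⟨j, hj⟩ := hx.exists_dist_le_of_mem_elementaryClosure hX h1 m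
    rw [zpow_natCast] at hj
    have h3 := hmove t h1 h2
    have h4 := dist_triangle4 s (t • s) (t • f ^ m • s) (f ^ j • s)
    rw [dist_smul] at h4
    have h5 := hx.upper 0 m
    have h6 := hx.lower 0 j
    simp only [zpow_zero, one_smul, zpow_natCast, zero_sub, Int.cast_neg, abs_neg,
      Int.cast_natCast, Nat.abs_cast] at h5 h6
    have h7 : κ * |(j : ℝ)| ≤ κ * J := by linarith
    have h8 := abs_le.1 (le_of_mul_le_mul_left h7 hκ)
    simp only [Set.mem_iUnion, Finset.mem_Icc]
    refine ⟨j, ⟨?_, ?_⟩, h3, hj⟩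
    · exact_mod_cast h8.1
    · exact_mod_cast h8.2

end Axis

/-! ### Spaces close to a quasi-line are elementary -/

section Boundary

variable {X : Type*} [MetricSpace X] {δ : ℝ} {x : ℤ → X} {c κ : ℝ}

/-- Two sequences converge to the same boundary point if they stay close to the same half of a
quasi-line. -/
theorem IsQuasiLine.sameLimit (hx : IsQuasiLine x c κ) {b : ℝ} {u v : SequenceToInfinity X}
    {j k : ℕ → ℤ} (hj : ∀ n, dist (u.1 n) (x (j n)) ≤ b) (hk : ∀ n, dist (v.1 n) (x (k n)) ≤ b)
    (hj0 : ∀ᶠ n in atTop, 0 ≤ j n) (hk0 : ∀ᶠ n in atTop, 0 ≤ k n) : SameLimit u v := by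
  intro p
  have hinf : ∀ w : SequenceToInfinity X, Tendsto (fun n => dist (x 0) (w.1 n)) atTop atTop := by
    intro w
    refine ((w.2 (x 0)).comp tendsto_atTop_diagonal).congr fun n => ?_
    simp [gromovProduct, dist_comm]
  rw [tendsto_atTop]
  intro A
  filter_upwards [hj0, hk0,
    tendsto_atTop.1 (hinf u) (A + dist (x 0) p + c / 2 + 3 * b),
    tendsto_atTop.1 (hinf v) (A + dist (x 0) p + c / 2 + 3 * b)] with n h1 h2 h3 h4
  have h5 := hx.min_dist_le_gromovProduct h1 h2
  have h6 := dist_triangle_right (x 0) (u.1 n) (x (j n))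
  have h7 := dist_triangle_right (x 0) (v.1 n) (x (k n))
  have h8 := gromovProduct_le_add_dist (x 0) (x (j n)) (x (k n)) (v.1 n)
  have h9 := gromovProduct_le_add_dist (x 0) (v.1 n) (x (j n)) (u.1 n)
  rw [gromovProduct_comm, gromovProduct_comm _ (v.1 n) (u.1 n)] at h9
  have h10 := gromovProduct_le_add_dist_base (x 0) p (u.1 n) (v.1 n)
  have h11 := hj n
  have h12 := hk n
  have h13 := dist_triangle (x 0) (x (j n)) (u.1 n)
  have h14 := dist_triangle (x 0) (x (k n)) (v.1 n)
  rw [dist_comm _ (x (j n))] at h11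
  rw [dist_comm _ (x (k n))] at h12
  have h15 : A + dist (x 0) p + c / 2 + 2 * b ≤ min (dist (x 0) (x (j n))) (dist (x 0) (x (k n))) :=
    le_min (by linarith) (by linarith)
  linarith

theorem IsQuasiLine.not_isNonElementary (hx : IsQuasiLine x c κ) {b : ℝ}
    (hb : ∀ y : X, ∃ j, dist y (x j) ≤ b) : ¬ IsNonElementary X := by
  choose J hJ using hb
  have dich : ∀ u : SequenceToInfinity X, (∀ᶠ n in atTop, 0 ≤ J (u.1 n)) ∨
      ∀ᶠ n in atTop, 0 ≤ -J (u.1 n) := by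
    intro u
    obtain ⟨⟨m₁, m₂⟩, hm⟩ := eventually_atTop.1
      (tendsto_atTop.1 (u.2 (x 0)) (c / 2 + 2 * b + 1))
    set m := max m₁ m₂
    by_cases h0 : 0 ≤ J (u.1 m)
    · left
      filter_upwards [eventually_ge_atTop m] with n hn
      by_contra! hlt
      have h1 := hm (n, m) ⟨(le_max_left _ _).trans hn, le_max_right _ _⟩
      have h2 := hx.gromovProduct_le hlt.le h0
      have h3 := gromovProduct_le_add_dist (x 0) (u.1 n) (u.1 m) (x (J (u.1 m)))
      have h4 := gromovProduct_le_add_dist (x 0) (x (J (u.1 m))) (u.1 n) (x (J (u.1 n)))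
      rw [gromovProduct_comm, gromovProduct_comm _ _ (x (J (u.1 n)))] at h4
      linarith [hJ (u.1 m), hJ (u.1 n)]
    · right
      filter_upwards [eventually_ge_atTop m] with n hn
      by_contra! hlt
      have h1 := hm (m, n) ⟨le_max_left _ _, (le_max_right _ _).trans hn⟩
      have h2 := hx.gromovProduct_le (not_le.1 h0).le (show 0 ≤ J (u.1 n) by omega)
      have h3 := gromovProduct_le_add_dist (x 0) (u.1 m) (u.1 n) (x (J (u.1 n)))
      have h4 := gromovProduct_le_add_dist (x 0) (x (J (u.1 n))) (u.1 m) (x (J (u.1 m)))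
      rw [gromovProduct_comm, gromovProduct_comm _ _ (x (J (u.1 m)))] at h4
      linarith [hJ (u.1 m), hJ (u.1 n)]
  have inj : Function.Injective fun q : GromovBoundary X =>
      (∀ᶠ n in atTop, 0 ≤ J ((Quot.out q).1 n)) := by
    intro q r hqr
    simp only [eq_iff_iff] at hqr
    rw [← Quot.out_eq q, ← Quot.out_eq r]
    apply Quot.sound
    by_cases h : ∀ᶠ n in atTop, 0 ≤ J ((Quot.out q).1 n)
    · exact hx.sameLimit (fun n => hJ _) (fun n => hJ _) h (hqr.1 h)
    · exact hx.neg.sameLimit (b := b) (fun n => by rw [neg_neg]; exact hJ _)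
        (fun n => by rw [neg_neg]; exact hJ _) ((dich _).resolve_left h)
        ((dich _).resolve_left fun h' => h (hqr.2 h'))
  have hcard := ENat.card_le_card_of_injective inj
  rw [IsNonElementary, not_lt]
  refine hcard.trans ?_
  simp

end Boundary

/-! ### Subgroups with unbounded orbits -/

section Unbounded

variable {G : Type*} [Group G] {X : Type*} [MetricSpace X] [MulAction G X] [IsIsometricSMul G X]
  {δ : ℝ}

/-- Suppose that `a`, `b` and `a * b` stretch no point and that `b` moves `s` much further than `a`
does. Then `a` hardly moves the points `m` of a geodesic from `s` to `b • s` in an intermediate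
range: the geodesic and its image under `a` fellow travel there, so that `a` shifts `m` along the
geodesic by some `σ`, and `a ^ 2` shifts it by `2 * σ`, which bounds `σ`. -/
theorem IsHyperbolicSpace.dist_smul_le_of_not_isStretchedAt (hX : IsHyperbolicSpace δ X)
    {a b : G} {s m : X} {A : ℝ} (ha : ∀ y : X, ¬ IsStretchedAt δ a y) (hb : ¬ IsStretchedAt δ b s)
    (hab : ¬ IsStretchedAt δ (a * b) s) (hA : dist s (a • s) ≤ A)
    (hm : dist s m + dist m (b • s) = dist s (b • s)) (h1 : 2 * A + 4 * δ + 1 ≤ dist s m)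
    (h2 : dist s m + 2 * A + 4 * δ ≤ dist s (b • s) / 2) :
    dist m (a • m) ≤ 17 * δ := by
  have hd := hX.nonneg s
  have hA0 : 0 ≤ A := dist_nonneg.trans hA
  have inv : ∀ g : G, ¬ IsStretchedAt δ g s →
      dist s (g • s) / 2 - 3 / 2 * δ ≤ gromovProduct s (g • s) (g⁻¹ • s) := by
    intro g hg
    have e1 : dist (g⁻¹ • s) s = dist s (g • s) := by rw [dist_smul_left, inv_inv]
    have e2 : dist (g • s) (g⁻¹ • s) = dist s (g ^ 2 • s) := by
      rw [dist_comm, dist_smul_left, inv_inv, smul_smul, sq]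
    simp only [IsStretchedAt, not_lt] at hg
    simp only [gromovProduct, e1, e2, dist_comm (g • s) s]
    linarith
  have hbs := inv b hb
  have habs := inv (a * b) hab
  have eab : dist s (b • s) - A ≤ dist s ((a * b) • s) := by
    have := dist_triangle_left (a • s) ((a * b) • s) s
    rw [mul_smul, dist_smul] at this
    rw [mul_smul]
    linarith
  have hmid : dist s (b • s) - A ≤ gromovProduct s ((a * b)⁻¹ • s) (b⁻¹ • s) := by
    have e1 : dist ((a * b)⁻¹ • s) s = dist s ((a * b) • s) := by rw [dist_smul_left, inv_inv]
    have e2 : dist (b⁻¹ • s) s = dist s (b • s) := by rw [dist_smul_left, inv_inv]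
    have e3 : dist ((a * b)⁻¹ • s) (b⁻¹ • s) = dist s (a • s) := by
      rw [mul_inv_rev, mul_smul, dist_smul, dist_smul_left, inv_inv]
    simp only [gromovProduct, e1, e2, e3]
    linarith
  have hT := hX.min_three_le (A := dist s (b • s) / 2 - A / 2 - 3 / 2 * δ) (by linarith)
    (by linarith) (by rw [gromovProduct_comm]; linarith) (x := (a * b) • s) (w := b • s)
    (y := (a * b)⁻¹ • s) (z := b⁻¹ • s) (p := s)
  have hsam := dist_triangle s (a • s) (a • m)
  have hsam' := dist_triangle_left (a • s) (a • m) s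
  have hsam'' := dist_triangle_left s (a • m) (a • s)
  rw [dist_smul] at hsam hsam' hsam''
  rw [dist_comm (a • s) s] at hsam''
  have hv : gromovProduct (a • m) s ((a * b) • s) ≤ δ := by
    by_contra! hlt
    have h3 := hX (a • m) (a • s) s ((a * b) • s)
    have h4 : gromovProduct (a • m) (a • s) ((a * b) • s) = 0 := by
      rw [mul_smul, gromovProduct_smul]
      simp only [gromovProduct, dist_comm (b • s) m]
      linarith
    have h5 : δ < gromovProduct (a • m) (a • s) s := by
      simp only [gromovProduct, dist_smul, dist_comm (a • s) s]
      linarith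
    have h6 := lt_min h5 hlt
    linarith
  have hu : gromovProduct m s (b • s) ≤ δ := by
    simp only [gromovProduct, dist_comm (b • s) m]
    linarith
  have hdist := hX.dist_le_of_tripod (p := s) (x := b • s) (y := (a * b) • s) (u := m)
    (v := a • m) (C := δ) (e := |dist s m - dist s (a • m)|)
    (by rw [gromovProduct_comm]; linarith) hu hv le_rfl
  set σ := dist s m - dist s (a • m) with hσ
  have hσA : |σ| ≤ A := abs_le.2 ⟨by linarith, by linarith⟩
  -- The shift of `a ^ 2` is read off from the distances of `s` and `a⁻¹ • s` to `m` and `a • m`.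
  have e1 : dist (a⁻¹ • s) (a • m) = dist s (a ^ 2 • m) := by
    rw [dist_smul_left, inv_inv, smul_smul, sq]
  have e2 : dist (a⁻¹ • s) m = dist s (a • m) := by rw [dist_smul_left, inv_inv]
  have e3 : dist (a⁻¹ • s) s = dist s (a • s) := by rw [dist_smul_left, inv_inv]
  have h3 := hX.four_point (a⁻¹ • s) s (a • m) m
  have h4 := hX.four_point (a⁻¹ • s) s m (a • m)
  rw [e1, e2, e3, dist_comm (a • m) m] at h3
  rw [e1, e2, e3] at h4
  have h5 := dist_triangle_left s (a • m) (a⁻¹ • s)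
  rw [e1, e3] at h5
  have hup : dist s (a ^ 2 • m) ≤ dist s m - 2 * σ + 2 * δ := by
    rcases le_max_iff.1 (sub_le_iff_le_add.2 h3) with h | h <;> linarith
  have hlo : dist s m - 2 * σ - 2 * δ ≤ dist s (a ^ 2 • m) := by
    rcases le_max_iff.1 (sub_le_iff_le_add.2 h4) with h | h <;> linarith
  have h6 := ha m
  simp only [IsStretchedAt, not_lt] at h6
  have h7 := dist_triangle s m (a ^ 2 • m)
  have h8 := dist_triangle_right s m (a ^ 2 • m)
  rcases abs_cases σ with ⟨h, -⟩ | ⟨h, -⟩ <;> linarith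

/-- Otherwise, arbitrarily many elements would move two points at a large distance from each other,
on a geodesic from `s` to a much more distant orbit point, by a bounded amount. -/
theorem IsAcylindrical.exists_isStretchedAt (hgeod : IsGeodesicSpace X)
    (hX : IsHyperbolicSpace δ X) (hA : IsAcylindrical G X) {K : Subgroup G} {s : X}
    (hK : ¬ ∃ D, ∀ k ∈ K, dist s (k • s) ≤ D) : ∃ k ∈ K, ∃ y : X, IsStretchedAt δ k y := by
  by_contra! hno
  have hd := hX.nonneg s
  have hinf : (K : Set G).Infinite := by
    intro hfin
    obtain ⟨D, hD⟩ := (hfin.image fun k => dist s (k • s)).bddAbove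
    exact hK ⟨D, fun k hk => hD ⟨k, hk, rfl⟩⟩
  obtain ⟨M, N, hM, hMN⟩ := hA (17 * δ + 1) (by positivity)
  set a : ℕ → G := fun i => hinf.natEmbedding _ i with ha
  have haK : ∀ i, a i ∈ K := fun i => (hinf.natEmbedding _ i).2
  have hainj : Function.Injective a :=
    Subtype.val_injective.comp (hinf.natEmbedding _).injective
  set A := ∑ i ∈ Finset.range (N + 1), dist s (a i • s) with hAdef
  have haA : ∀ i ≤ N, dist s (a i • s) ≤ A := fun i hi =>
    Finset.single_le_sum (f := fun i => dist s (a i • s)) (fun _ _ => dist_nonneg)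
      (Finset.mem_range.2 (by omega))
  have hA0 : 0 ≤ A := dist_nonneg.trans (haA 0 (Nat.zero_le _))
  set t := 2 * A + 4 * δ + 1 with ht
  push Not at hK
  obtain ⟨b, hb, hbs⟩ := hK (2 * (t + M + 2 * A + 4 * δ))
  obtain ⟨c, hc0, hc1, hc⟩ := hgeod s (b • s)
  have hcs : ∀ r, 0 ≤ r → r ≤ dist s (b • s) →
      dist s (c r) = r ∧ dist s (c r) + dist (c r) (b • s) = dist s (b • s) := by
    intro r h0 h1
    have h2 := hc 0 ⟨le_rfl, dist_nonneg⟩ r ⟨h0, h1⟩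
    have h3 := hc r ⟨h0, h1⟩ _ ⟨dist_nonneg, le_rfl⟩
    rw [hc0, zero_sub, abs_neg, abs_of_nonneg h0] at h2
    rw [hc1, abs_sub_comm, abs_of_nonneg (sub_nonneg.2 h1)] at h3
    exact ⟨h2, by linarith⟩
  have move : ∀ r, t ≤ r → r ≤ t + M → ∀ i ≤ N, dist (c r) (a i • c r) ≤ 17 * δ + 1 := by
    intro r h0 h1 i hi
    obtain ⟨h2, h3⟩ := hcs r (by linarith) (by linarith)
    have := hX.dist_smul_le_of_not_isStretchedAt (hno _ (haK i)) (hno b hb s)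
      (hno _ (mul_mem (haK i) hb) s) (haA i hi) h3 (by linarith) (by linarith)
    linarith
  have hfar : M ≤ dist (c t) (c (t + M)) := by
    rw [hc t ⟨by linarith, by linarith⟩ _ ⟨by linarith, by linarith⟩]
    rw [abs_sub_comm, add_sub_cancel_left]
    exact le_abs_self M
  obtain ⟨i, j, hij, -, h⟩ := exists_lt_eq_of_encard_le (hMN _ _ hfar) (g := a)
    (fun i hi => ⟨move t le_rfl (by linarith) i hi, move (t + M) (by linarith) le_rfl i hi⟩)
  exact hij.ne (hainj h)

theorem IsEllipticSubgroup.exists_dist_le (hgeod : IsGeodesicSpace X)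
    (hX : IsHyperbolicSpace δ X) (hA : IsAcylindrical G X) {K : Subgroup G}
    (hK : IsEllipticSubgroup X K) (s : X) : ∃ D, ∀ k ∈ K, dist s (k • s) ≤ D := by
  by_contra h
  obtain ⟨k, hk, y, hy⟩ := hA.exists_isStretchedAt hgeod hX h
  obtain ⟨κ, hx⟩ := hy.exists_isQuasiLine hX
  exact hx.not_isElliptic (hK k hk)

theorem IsNonElementary.exists_isStretchedAt (hne : IsNonElementary X)
    (hgeod : IsGeodesicSpace X) (hX : IsHyperbolicSpace δ X) (hA : IsAcylindrical G X)
    (hcob : IsCobounded G X) : ∃ (f : G) (s : X), IsStretchedAt δ f s := by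
  have hnonempty : Nonempty (GromovBoundary X) := by
    by_contra h
    rw [not_nonempty_iff] at h
    rw [IsNonElementary, ENat.card_eq_zero_iff_empty _ |>.2 h] at hne
    exact absurd hne (by simp)
  obtain ⟨q⟩ := hnonempty
  obtain ⟨u, -⟩ := Quot.exists_rep q
  obtain ⟨f, -, y, hy⟩ := hA.exists_isStretchedAt hgeod hX (K := ⊤) (s := u.1 0) (by
    rintro ⟨D, hD⟩
    obtain ⟨B, hB, hGB⟩ := hcob
    obtain ⟨β, hβ⟩ := (Metric.isBounded_iff_subset_closedBall (u.1 0)).1 hB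
    obtain ⟨n, hn⟩ := (tendsto_atTop.1 ((u.2 (u.1 0)).comp tendsto_atTop_diagonal)
      (β + D + 1)).exists
    obtain ⟨g, b, hb, hgb⟩ := hGB (u.1 n)
    have h1 := hβ hb
    have h2 := hD g (Subgroup.mem_top g)
    have h3 := dist_triangle_right (g • b) (u.1 0) (g • u.1 0)
    rw [dist_smul, hgb] at h3
    simp only [Function.comp_apply, gromovProduct, dist_self] at hn
    rw [Metric.mem_closedBall] at h1
    linarith)
  exact ⟨f, y, hy⟩

/-- If the action is cobounded on a non-elementary space, then the elementary closure of `f` is not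
everything: otherwise the whole space would be close to the quasi-axis of `f`. -/
theorem IsQuasiLine.exists_notMem_elementaryClosure {f : G} {s : X} {c κ : ℝ}
    (hX : IsHyperbolicSpace δ X) (hx : IsQuasiLine (fun i : ℤ => f ^ i • s) c κ)
    (hne : IsNonElementary X) (hcob : IsCobounded G X) : ∃ a, a ∉ elementaryClosure f := by
  by_contra! hall
  obtain ⟨B, hB, hGB⟩ := hcob
  obtain ⟨β, hβ⟩ := (Metric.isBounded_iff_subset_closedBall s).1 hB
  refine hx.not_isNonElementary (b := β + (3 * c + 8 * δ)) (fun y => ?_) hne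
  obtain ⟨g, b, hb, rfl⟩ := hGB y
  obtain ⟨j, hj⟩ := hx.exists_dist_le_of_mem_elementaryClosure hX (hall g) 0
  rw [zpow_zero, one_smul] at hj
  refine ⟨j, (dist_triangle _ (g • s) _).trans ?_⟩
  rw [dist_smul]
  exact add_le_add (hβ hb) hj

/-- The largest normal subgroup in the elementary closure of `f` lies in two elementary closures
with diverging quasi-axes, hence is finite. -/
theorem IsQuasiLine.normalCore_elementaryClosure_eq_bot {f : G} {s : X} {c κ : ℝ}
    (hG : ∀ F : Subgroup G, F.Normal → (F : Set G).Finite → F = ⊥)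
    (hX : IsHyperbolicSpace δ X) (hA : IsAcylindrical G X) (hne : IsNonElementary X)
    (hcob : IsCobounded G X) (hx : IsQuasiLine (fun i : ℤ => f ^ i • s) c κ) :
    (elementaryClosure f).normalCore = ⊥ := by
  obtain ⟨a, ha⟩ := hx.exists_notMem_elementaryClosure hX hne hcob
  refine hG _ inferInstance ((hA.finite_inter_elementaryClosure hX hx ha).subset fun t ht => ?_)
  refine ⟨Subgroup.normalCore_le _ ht, ?_⟩
  have := ht a⁻¹
  rwa [inv_inv] at this

end Unbounded

/-! ### Making the elementary closure intersect a family of elliptic subgroups trivially -/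

section Conjugation

variable {G : Type*} [Group G] {X : Type*} [MetricSpace X] [MulAction G X] [IsIsometricSMul G X]
  {δ : ℝ}

/-- An element that moves `p` by at most `E` and `q` by at most `D` moves the points coarsely on
a geodesic from `p` to `q`, and far away from `q`, by an amount that does not depend on `D`. -/
theorem IsHyperbolicSpace.dist_smul_le_of_far (hX : IsHyperbolicSpace δ X) {t : G} {p q z : X}
    {c E D : ℝ} (hp : dist p (t • p) ≤ E) (hq : dist q (t • q) ≤ D)
    (hz : dist p z + dist z q ≤ dist p q + c) (hfar : dist p z + D + E ≤ dist p q) :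
    dist z (t • z) ≤ c + E + 4 * δ := by
  have hd := hX.nonneg z
  have h1 := hX.four_point (t • z) p q (t • q)
  have h2 := hX.four_point z p (t • z) q
  have h3 := dist_triangle_left (t • p) (t • q) p
  have h4 := dist_triangle p (t • p) (t • z)
  rw [dist_smul] at h1 h3 h4
  have h5 : 0 ≤ dist z q := dist_nonneg
  rw [dist_comm (t • z) p] at h1
  rw [dist_comm z p] at h2
  have h6 : dist (t • z) q ≤ dist z q + E + 2 * δ := by
    rcases le_max_iff.1 (sub_le_iff_le_add.2 h1) with h | h <;> linarith
  rcases le_max_iff.1 (sub_le_iff_le_add.2 h2) with h | h <;> linarith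

/-- Let `a` be outside of the elementary closure of `f`, and let the elements of `S` move points by
a bounded amount. Conjugating `f` by a high power of `a * f * a⁻¹`, one makes all elements of `S`
that preserve the quasi-axis of the new element preserve the quasi-axes of both `f` and
`a * f * a⁻¹`.

With `y = a • f ^ n • s`, what has to be shown is that an element `t` of the elementary closure
of `f` that moves `y` by at most `D` preserves the quasi-axis of `a * f * a⁻¹`. As `t` preserves the
quasi-axis of `f`, to which `y` projects near `s`, it moves `s` by an amount independent of `D`,
hence also long pieces of the quasi-axis from `a • s` to `y`. Thus `t` commutes with some power of
`a * f * a⁻¹`, whose exponent depends neither on `t` nor on `D`, and `n` is chosen to be a multiple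
of that exponent. -/
theorem IsAcylindrical.exists_conj_mem_elementaryClosure (hX : IsHyperbolicSpace δ X)
    (hA : IsAcylindrical G X) {f : G} {s : X} {c κ : ℝ}
    (hx : IsQuasiLine (fun i : ℤ => f ^ i • s) c κ) {a : G} (ha : a ∉ elementaryClosure f)
    {S : Set G} {D : ℝ} (hS : ∀ h ∈ S, dist (a • s) (h • a • s) ≤ D) :
    ∃ b : G, ∀ h ∈ S, h ∈ elementaryClosure (b * f * b⁻¹) →
      h ∈ elementaryClosure f ∧ a⁻¹ * h * a ∈ elementaryClosure f := by
  have hc := hx.c_pos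
  have hκ := hx.pos
  have hd := hX.nonneg s
  obtain ⟨C, hC⟩ := hA.exists_gromovProduct_le hX hx (dist s (a • s))
  have hCa := hC a ha le_rfl
  have hC0 : 0 ≤ C := (gromovProduct_nonneg _ _ _).trans (hCa 0 0)
  set c₀ := 3 * c + 8 * δ with hc₀
  set E := 2 * C + 2 * c₀ + δ + 2 * dist s (a • s) with hE
  have hE0 : 0 ≤ E := by positivity
  obtain ⟨R, m, hm, hR⟩ := hA.exists_conj_pow_eq_self hX hx (c + E + 4 * δ)
  obtain ⟨q, hq⟩ := exists_nat_ge
    (R + (c * R + |D| + E + (|D| / 2 + 2 * C + 2 * c₀ + δ + dist s (a • s) + 1)) / κ)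
  set n : ℕ := m * q with hn
  have hqn : (q : ℝ) ≤ n := by exact_mod_cast Nat.le_mul_of_pos_left q hm
  set W := c * R + |D| + E + (|D| / 2 + 2 * C + 2 * c₀ + δ + dist s (a • s) + 1) with hW
  have hW0 : 0 ≤ W := by positivity
  have hRn : R ≤ n := by
    have : (R : ℝ) ≤ n := by
      have : 0 ≤ W / κ := by positivity
      linarith
    exact_mod_cast this
  have hnW : W ≤ dist s (f ^ n • s) := by
    have h1 := hx.lower 0 n
    have h2 : W / κ ≤ n := by
      have : (0 : ℝ) ≤ R := Nat.cast_nonneg R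
      linarith
    rw [div_le_iff₀' hκ] at h2
    simp only [zpow_zero, one_smul, zpow_natCast, zero_sub, Int.cast_neg, abs_neg,
      Int.cast_natCast, Nat.abs_cast] at h1
    linarith
  have hDabs := le_abs_self D
  obtain ⟨u, hu⟩ : ∃ u, u = a * f ^ n * a⁻¹ := ⟨_, rfl⟩
  refine ⟨u⁻¹, fun h hhS hh => ?_⟩
  rw [mem_elementaryClosure_conj, inv_inv] at hh
  obtain ⟨t, ht⟩ : ∃ t, t = u * h * u⁻¹ := ⟨_, rfl⟩
  obtain ⟨y, hy⟩ : ∃ y, y = a • f ^ n • s := ⟨_, rfl⟩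
  rw [← ht] at hh
  have huy : u • a • s = y := by simp only [hu, hy, mul_smul, inv_smul_smul]
  have hty : dist y (t • y) ≤ D := by
    rw [← huy, ht, mul_smul, mul_smul, inv_smul_smul, dist_smul]
    exact hS h hhS
  have hays : W - dist s (a • s) ≤ dist y s := by
    have h1 := dist_triangle (a • s) s y
    rw [hy, dist_smul, dist_comm (a • s) s, dist_comm s (a • f ^ n • s)] at h1
    rw [hy]
    linarith
  have proj : ∀ t ∈ elementaryClosure f,
      dist y s + dist s (t • s) - 2 * C - 2 * c₀ ≤ dist y (t • s) := by
    intro t ht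
    obtain ⟨j, hj⟩ := hx.exists_dist_le_of_mem_elementaryClosure hX ht 0
    rw [zpow_zero, one_smul] at hj
    have h1 := hCa n j
    rw [zpow_natCast, ← hy] at h1
    simp only [gromovProduct] at h1
    have h2 := dist_triangle y (t • s) (f ^ j • s)
    have h3 := dist_triangle_right s (t • s) (f ^ j • s)
    rw [dist_comm (f ^ j • s) s] at h1
    linarith
  have hts : dist s (t • s) ≤ 2 * C + 2 * c₀ + δ := by
    have h1 := proj t hh
    have h2 := proj t⁻¹ (inv_mem hh)
    have e1 : dist s (t⁻¹ • s) = dist s (t • s) := by rw [← dist_smul_left, dist_comm]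
    have e2 : dist y (t⁻¹ • s) = dist (t • y) s := by rw [← dist_smul_left]
    rw [e1, e2] at h2
    have h3 := hX.four_point y (t • y) (t • s) s
    rw [dist_smul, dist_comm (t • s) s] at h3
    have h4 : 0 ≤ dist s (t • s) := dist_nonneg
    have h5 : |D| / 2 + 2 * C + 2 * c₀ + δ + 1 ≤ dist y s := by
      have : 0 ≤ c * R := by positivity
      have := abs_nonneg D
      linarith
    rcases le_max_iff.1 (sub_le_iff_le_add.2 h3) with h | h <;> linarith
  have htp : dist (a • s) (t • a • s) ≤ E := by
    have h1 := dist_triangle4 (a • s) s (t • s) (t • a • s)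
    rw [dist_smul, dist_comm (a • s) s] at h1
    linarith
  have htz : dist (a • f ^ R • s) (t • a • f ^ R • s) ≤ c + E + 4 * δ := by
    refine hX.dist_smul_le_of_far htp hty ?_ ?_
    · have h1 := hx.add (i := 0) (j := R) (k := n) (by omega) (by omega)
      simp only [zpow_zero, one_smul, zpow_natCast] at h1
      simpa only [hy, dist_smul] using h1
    · have h1 := hx.upper 0 R
      simp only [zpow_zero, one_smul, zpow_natCast, zero_sub, Int.cast_neg, abs_neg,
        Int.cast_natCast, Nat.abs_cast] at h1
      simp only [hy, dist_smul]
      have := abs_nonneg D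
      have : 0 ≤ dist s (a • s) := dist_nonneg
      linarith
  have hcomm := hR (a⁻¹ * t * a)
    (by rw [mul_smul, mul_smul, dist_smul_left, inv_inv, dist_comm]; linarith)
    (by rw [mul_smul, mul_smul, dist_smul_left, inv_inv, dist_comm]; exact htz)
  have hcomm' : a⁻¹ * t * a * f ^ n * (a⁻¹ * t * a)⁻¹ = f ^ n := by
    rw [hn, pow_mul, ← conj_pow, hcomm]
  have htu : t * u = u * t := by
    rw [mul_inv_eq_iff_eq_mul] at hcomm'
    have h1 := congrArg (fun g => a * g * a⁻¹) hcomm'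
    simp only [mul_assoc, mul_inv_cancel_left] at h1
    simp only [hu, mul_assoc, h1, mul_inv_cancel, mul_one]
  have hth : t = h := by
    have h1 : u * h = u * t := by
      rw [← htu, ht, inv_mul_cancel_right]
    exact (mul_left_cancel h1).symm
  rw [← hth]
  exact ⟨hh, m, hm, Or.inl hcomm⟩

/-- One conjugation makes the intersection of the elementary closure with `S` finite. Each further
one removes a given element `t ≠ 1` of the intersection: as the normal core of the elementary
closure is trivial, `t` is missing from some conjugate of the elementary closure. -/
theorem IsAcylindrical.exists_isStretchedAt_inter_eq_one
    (hG : ∀ F : Subgroup G, F.Normal → (F : Set G).Finite → F = ⊥)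
    (hX : IsHyperbolicSpace δ X) (hA : IsAcylindrical G X) (hne : IsNonElementary X)
    (hcob : IsCobounded G X) {f : G} {s : X} (hf : IsStretchedAt δ f s) {S : Set G}
    (hS : ∀ y : X, ∃ D, ∀ h ∈ S, dist y (h • y) ≤ D) :
    ∃ (g : G) (y : X), IsStretchedAt δ g y ∧ ∀ h ∈ S, h ∈ elementaryClosure g → h = 1 := by
  have induct : ∀ (n : ℕ) (f : G) (s : X), IsStretchedAt δ f s →
      (S ∩ elementaryClosure f : Set G).Finite → (S ∩ elementaryClosure f : Set G).ncard ≤ n →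
      ∃ (g : G) (y : X), IsStretchedAt δ g y ∧ ∀ h ∈ S, h ∈ elementaryClosure g → h = 1 := by
    intro n
    induction n with
    | zero =>
      intro f s hf hfin hcard
      rw [Nat.le_zero, Set.ncard_eq_zero hfin] at hcard
      exact ⟨f, s, hf, fun h h1 h2 =>
        (Set.eq_empty_iff_forall_notMem.1 hcard h ⟨h1, h2⟩).elim⟩
    | succ n ih =>
      intro f s hf hfin hcard
      by_cases hone : ∀ h ∈ S, h ∈ elementaryClosure f → h = 1
      · exact ⟨f, s, hf, hone⟩
      · push Not at hone
        obtain ⟨t, htS, htf, ht1⟩ := hone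
        obtain ⟨κ, hx⟩ := hf.exists_isQuasiLine hX
        have hcore := hx.normalCore_elementaryClosure_eq_bot hG hX hA hne hcob
        have ht : t ∉ (elementaryClosure f).normalCore := by
          rw [hcore]
          exact ht1
        obtain ⟨b, hb⟩ : ∃ b, b * t * b⁻¹ ∉ elementaryClosure f := not_forall.1 ht
        have hbf : b⁻¹ ∉ elementaryClosure f := fun h =>
          hb (mul_mem (mul_mem (inv_mem_iff.1 h) htf) h)
        obtain ⟨D, hD⟩ := hS (b⁻¹ • s)
        obtain ⟨e, he⟩ := hA.exists_conj_mem_elementaryClosure hX hx hbf hD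
        have hsub : (S ∩ elementaryClosure (e * f * e⁻¹) : Set G) ⊂ S ∩ elementaryClosure f := by
          refine (Set.ssubset_iff_of_subset fun h hh => ?_).2 ⟨t, ⟨htS, htf⟩, fun hh => hb ?_⟩
          · exact ⟨hh.1, (he h hh.1 hh.2).1⟩
          have := (he t htS hh.2).2
          rwa [inv_inv] at this
        refine ih _ _ (hf.conj e) (hfin.subset hsub.subset) ?_
        have := Set.ncard_lt_ncard hsub hfin
        omega
  obtain ⟨κ, hx⟩ := hf.exists_isQuasiLine hX
  obtain ⟨a, ha⟩ := hx.exists_notMem_elementaryClosure hX hne hcob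
  obtain ⟨D, hD⟩ := hS (a • s)
  obtain ⟨b, hb⟩ := hA.exists_conj_mem_elementaryClosure hX hx ha hD
  exact induct _ _ _ (hf.conj b)
    ((hA.finite_inter_elementaryClosure hX hx ha).subset fun h hh => hb h hh.1 hh.2) le_rfl

end Conjugation

/-! ### Points moved by a bounded amount -/

section QuasiMinimal

variable {G : Type*} [Group G] {X : Type*} [MetricSpace X] [MulAction G X] [IsIsometricSMul G X]
  {δ : ℝ} {g : G} {s : X} {c κ : ℝ}

/-- A point that `g` moves by at most `ρ` is close to the quasi-axis of `g`: some power `g ^ (2 ^ i)`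
with bounded `i` stretches the point, as otherwise the distances from it to its images
under `g ^ (2 ^ i)` would grow linearly in `i`; so the point lies on a quasi-line with the same
endpoints as the quasi-axis of `g`. -/
theorem IsQuasiLine.exists_dist_le_of_dist_smul_le (hX : IsHyperbolicSpace δ X)
    (hx : IsQuasiLine (fun i : ℤ => g ^ i • s) c κ) (ρ : ℝ) :
    ∃ b, ∀ y : X, dist y (g • y) ≤ ρ → ∃ j : ℤ, dist y (g ^ j • s) ≤ b := by
  have hc := hx.c_pos
  have hκ := hx.pos
  have hd := hX.nonneg s
  have growth : ∃ J : ℕ, ρ + 3 * δ * J < κ * 2 ^ J := by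
    obtain ⟨i, hi⟩ := exists_nat_gt ((|ρ| + 6 * δ) / κ)
    rw [div_lt_iff₀' hκ] at hi
    refine ⟨2 * i, ?_⟩
    have h1 : ((i : ℝ) + 1) ≤ 2 ^ i := by exact_mod_cast Nat.lt_two_pow_self (n := i)
    have h2 : ((i : ℝ) + 1) * (i + 1) ≤ 2 ^ (2 * i) := by
      rw [two_mul, pow_add]
      gcongr
    have h3 : (|ρ| + 6 * δ) * (i + 1) ≤ κ * i * (i + 1) := by gcongr
    have h4 : κ * (((i : ℝ) + 1) * (i + 1)) ≤ κ * 2 ^ (2 * i) := by gcongr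
    have h5 := le_abs_self ρ
    have h6 : 0 ≤ |ρ| * i := by positivity
    have h7 : 0 < κ * (i + 1) := by positivity
    push_cast
    nlinarith
  obtain ⟨J, hJ⟩ := growth
  set c' := 2 ^ J * ρ + 2 * δ with hc'
  refine ⟨2 * c + 2 * (c' / 2 + 2 * δ) + 4 * δ, fun y hy => ?_⟩
  have hρ : 0 ≤ ρ := dist_nonneg.trans hy
  obtain ⟨i, hiJ, hi⟩ : ∃ i < J, IsStretchedAt δ (g ^ 2 ^ i) y := by
    by_contra! hno
    have hle : ∀ i ≤ J, dist y (g ^ 2 ^ i • y) ≤ ρ + 3 * δ * i := by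
      intro i
      induction i with
      | zero => intro _; simpa using hy
      | succ i ih =>
        intro hi
        have h1 := hno i (by omega)
        simp only [IsStretchedAt, not_lt, ← pow_mul, ← pow_succ] at h1
        have h2 := ih (by omega)
        push_cast
        linarith
    have h1 := hle J le_rfl
    have h2 := hx.le_dist_zpow_smul y (2 ^ J : ℕ)
    rw [zpow_natCast] at h2
    simp only [Int.cast_natCast, Nat.abs_cast] at h2
    push_cast at h2
    linarith
  obtain ⟨κ', hx'⟩ := hi.exists_isQuasiLine hX
  have hcc' : dist y (g ^ 2 ^ i • y) + 2 * δ ≤ c' := by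
    have h1 := dist_pow_smul_le g y (2 ^ i)
    have h2 : ((2 ^ i : ℕ) : ℝ) ≤ 2 ^ J := by
      exact_mod_cast Nat.pow_le_pow_right (by norm_num) hiJ.le
    have h3 : ((2 ^ i : ℕ) : ℝ) * dist y (g • y) ≤ 2 ^ J * ρ := by gcongr
    linarith
  obtain ⟨k, hk⟩ := exists_nat_gt ((c' / 2 + 2 * δ + dist y s) / κ)
  rw [div_lt_iff₀' hκ] at hk
  set n : ℕ := 2 ^ i * k with hn
  have hkn : (k : ℝ) ≤ n := by
    exact_mod_cast Nat.le_mul_of_pos_left k (Nat.two_pow_pos i)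
  have hkn' : κ * (k : ℝ) ≤ κ * n := by gcongr
  have hfar : c' / 2 + 2 * δ + dist y s < dist y (g ^ (n : ℤ) • y) := by
    have h1 := hx.le_dist_zpow_smul y n
    simp only [Int.cast_natCast, Nat.abs_cast] at h1
    linarith
  have hg : gromovProduct y (g ^ (-(n : ℤ)) • y) (g ^ (n : ℤ) • y) ≤ c' / 2 := by
    have h1 := hx'.gromovProduct_le (i := -k) (j := 0) (k := k) (by omega) (by omega)
    simp only [zpow_zero, one_smul, zpow_neg, zpow_natCast, ← pow_mul] at h1
    simp only [zpow_neg, zpow_natCast]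
    linarith
  have h1 := hX.gromovProduct_le_of_far (x' := g ^ (-(n : ℤ)) • s) (y' := g ^ (n : ℤ) • s) hg
    (by rw [dist_smul, dist_zpow_neg_smul]; exact hfar) (by rw [dist_smul]; exact hfar)
  exact hx.exists_dist_le hX (by omega) h1

theorem IsAcylindrical.isBounded_quasiAxis_inter_quasiFix (hX : IsHyperbolicSpace δ X)
    (hA : IsAcylindrical G X) (hx : IsQuasiLine (fun i : ℤ => g ^ i • s) c κ) {H : Subgroup G}
    {h : G} (hH : h ∈ H) (hh : h ∉ elementaryClosure g) (r K : ℝ) :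
    Bornology.IsBounded (quasiAxis X r g ∩ quasiFix X K H) := by
  obtain ⟨b, hb⟩ := hx.exists_dist_le_of_dist_smul_le hX ((⨅ y : X, dist y (g • y)) + r)
  obtain ⟨R, hR⟩ := hA.exists_mem_elementaryClosure hX hx (K + 2 * b)
  have hc := hx.c_pos
  rw [Metric.isBounded_iff]
  refine ⟨2 * b + c * R, fun y ⟨hy1, hy2⟩ z ⟨hz1, hz2⟩ => ?_⟩
  obtain ⟨i, hi⟩ := hb y hy1
  obtain ⟨j, hj⟩ := hb z hz1
  have move : ∀ (w : X) (i : ℤ), dist w (g ^ i • s) ≤ b → dist w (h • w) ≤ K →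
      dist (h • g ^ i • s) (g ^ i • s) ≤ K + 2 * b := by
    intro w i h1 h2
    have := dist_triangle4 (h • g ^ i • s) (h • w) w (g ^ i • s)
    rw [dist_smul, dist_comm (g ^ i • s) w, dist_comm (h • w)] at this
    linarith
  have hij : ¬ (R : ℤ) ≤ |i - j| := fun hle =>
    hh (hR h i j i j hle (move y i hi (hy2 h hH)) (move z j hj (hz2 h hH)))
  have hij' : |((i - j : ℤ) : ℝ)| ≤ R := by exact_mod_cast (not_le.1 hij).le
  have h1 := hx.upper i j
  have h2 := dist_triangle4_right y z (g ^ i • s) (g ^ j • s)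
  have h3 : c * |((i - j : ℤ) : ℝ)| ≤ c * R := by gcongr
  linarith

end QuasiMinimal

/-! ### Ping-pong -/

section PingPong

variable {G : Type*} [Group G]

/-- The ping-pong lemma for two subgroups and a set and its complement. -/
theorem injective_coprod_lift_of_ping_pong {X : Type*} [MulAction G X] {A B : Subgroup G}
    [Infinite A] {U : Set X} (hU : U.Nonempty) (hU' : Uᶜ.Nonempty)
    (hA : ∀ a ∈ A, a ≠ 1 → ∀ x ∉ U, a • x ∈ U) (hB : ∀ b ∈ B, b ≠ 1 → ∀ x ∈ U, b • x ∉ U) :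
    Function.Injective (Monoid.Coprod.lift A.subtype B.subtype) := by
  let K : Bool → Subgroup G := fun i => cond i A B
  let V : Bool → Set X := fun i => cond i U Uᶜ
  have hinj : Function.Injective (Monoid.CoprodI.lift fun i => (K i).subtype) := by
    refine Monoid.CoprodI.lift_injective_of_ping_pong (fun i => (K i).subtype) (Or.inr ⟨true, ?_⟩)
      V ?_ ?_ ?_
    · exact (Cardinal.natCast_lt_aleph0 (n := 3)).le.trans (Cardinal.aleph0_le_mk A)
    · rintro (_ | _)
      · exact hU'
      · exact hU
    · rintro (_ | _) (_ | _) h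
      · exact absurd rfl h
      · exact disjoint_compl_left
      · exact disjoint_compl_right
      · exact absurd rfl h
    · rintro (_ | _) (_ | _) h ⟨k, hk⟩ hk1
      · exact absurd rfl h
      · rintro _ ⟨x, hx, rfl⟩
        exact hB k hk (fun h => hk1 (Subtype.ext h)) x hx
      · rintro _ ⟨x, hx, rfl⟩
        exact hA k hk (fun h => hk1 (Subtype.ext h)) x hx
      · exact absurd rfl h
  let φ : Monoid.Coprod A B →* Monoid.CoprodI fun i => K i :=
    Monoid.Coprod.lift (Monoid.CoprodI.of (M := fun i => K i) (i := true))
      (Monoid.CoprodI.of (M := fun i => K i) (i := false))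
  let ψ : (Monoid.CoprodI fun i => K i) →* Monoid.Coprod A B :=
    Monoid.CoprodI.lift fun i => match i with
      | true => (Monoid.Coprod.inl : A →* Monoid.Coprod A B)
      | false => (Monoid.Coprod.inr : B →* Monoid.Coprod A B)
  have hψφ : ψ.comp φ = MonoidHom.id _ := by
    ext x
    · simp [φ, ψ]
    · simp [φ, ψ]
  have hφ : Function.Injective φ :=
    Function.LeftInverse.injective (g := ψ) fun x => DFunLike.congr_fun hψφ x
  have hcomp : Monoid.Coprod.lift A.subtype B.subtype =
      (Monoid.CoprodI.lift fun i => (K i).subtype).comp φ := by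
    ext x
    · simp [φ, K]
    · simp [φ, K]
  rw [hcomp]
  exact hinj.comp hφ

theorem isInternalFreeProduct_of_injective {γ : G} {H : Subgroup G}
    (h : Function.Injective (Monoid.Coprod.lift (Subgroup.zpowers γ).subtype H.subtype)) :
    IsInternalFreeProduct (Subgroup.closure ({γ} ∪ (H : Set G))) (Subgroup.zpowers γ) H := by
  refine ⟨h, ?_⟩
  rw [Monoid.Coprod.range_lift, Subgroup.range_subtype, Subgroup.range_subtype,
    Subgroup.closure_union, Subgroup.closure_eq, Subgroup.zpowers_eq_closure]

variable {X : Type*} [MetricSpace X] [MulAction G X] [IsIsometricSMul G X] {δ : ℝ} {g : G} {s : X}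
  {c κ : ℝ}

/-- Ping-pong with the set `U` of points whose projection to the quasi-axis of `g` is far away from
the base point `s`. Powers of `g ^ N` move the complement of `U` into `U`, and non-trivial elements
of `H` move `U` into its complement, because they move the quasi-axis of `g` to a quasi-line that
projects close to `s`. -/
theorem IsAcylindrical.exists_isInternalFreeProduct (hX : IsHyperbolicSpace δ X)
    (hA : IsAcylindrical G X) (hx : IsQuasiLine (fun i : ℤ => g ^ i • s) c κ) {D : ℝ} :
    ∃ N₀ : ℕ, ∀ N : ℕ, N₀ ≤ N → ∀ H : Subgroup G, (∀ h ∈ H, dist s (h • s) ≤ D) →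
      (∀ h ∈ H, h ∈ elementaryClosure g → h = 1) →
      IsInternalFreeProduct (Subgroup.closure ({g ^ N} ∪ (H : Set G)))
        (Subgroup.zpowers (g ^ N)) H := by
  have hκ := hx.pos
  have hd := hX.nonneg s
  obtain ⟨C, hC⟩ := hA.exists_gromovProduct_le hX hx D
  set T := |C| + |D| + δ with hT
  have hT0 : 0 ≤ T := by positivity
  obtain ⟨N₀, hN₀⟩ := exists_nat_gt (2 * T / κ)
  rw [div_lt_iff₀' hκ] at hN₀
  refine ⟨N₀, fun N hN H hHD hH => isInternalFreeProduct_of_injective ?_⟩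
  have hlong : ∀ n : ℤ, n ≠ 0 → 2 * T < dist s (g ^ (N * n) • s) := by
    intro n hn
    have h1 := hx.lower 0 (N * n)
    simp only [zpow_zero, one_smul, zero_sub, Int.cast_neg, abs_neg, Int.cast_mul,
      Int.cast_natCast, abs_mul, Nat.abs_cast] at h1
    have h2 : (1 : ℝ) ≤ |(n : ℝ)| := by exact_mod_cast Int.one_le_abs hn
    have h3 : (N₀ : ℝ) ≤ N := by exact_mod_cast hN
    have h4 : κ * (N₀ : ℝ) ≤ κ * (N * |(n : ℝ)|) := by
      gcongr
      exact h3.trans (le_mul_of_one_le_right (by positivity) h2)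
    linarith
  have hself : ∀ y : X, gromovProduct s y y = dist s y := fun y => by
    simp [gromovProduct, dist_comm]
  have hpow : ∀ n : ℤ, (g ^ N) ^ n = g ^ (N * n : ℤ) := fun n => by
    rw [zpow_mul, zpow_natCast]
  have : Infinite (Subgroup.zpowers (g ^ N)) := by
    rw [← not_finite_iff_infinite]
    intro hfin
    obtain ⟨n, hn, hn1⟩ := isOfFinOrder_iff_pow_eq_one.1
      (finite_zpowers.1 (Set.toFinite (Subgroup.zpowers (g ^ N) : Set G)))
    have := hlong n (by omega)
    rw [← hpow, zpow_natCast, hn1, one_smul, dist_self] at this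
    linarith
  refine injective_coprod_lift_of_ping_pong
    (U := {y : X | ∃ k : ℤ, T < gromovProduct s y (g ^ k • s)}) ?_ ?_ ?_ ?_
  · refine ⟨g ^ (N * 1 : ℤ) • s, (N * 1 : ℤ), ?_⟩
    rw [hself]
    linarith [hlong 1 one_ne_zero]
  · refine ⟨s, ?_⟩
    rintro ⟨k, hk⟩
    simp only [gromovProduct, dist_self, dist_comm s] at hk
    linarith
  · rintro _ ⟨n, rfl⟩ hne y hy
    have hn : n ≠ 0 := by
      rintro rfl
      exact hne (zpow_zero _)
    simp only [hpow]
    refine ⟨N * n, ?_⟩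
    have h1 : gromovProduct s y (g ^ (-(N * n : ℤ)) • s) ≤ T := not_lt.1 fun h => hy ⟨_, h⟩
    have h2 := gromovProduct_add s (g ^ (-(N * n : ℤ)) • s) y
    rw [gromovProduct_comm s] at h2
    have h3 : gromovProduct s (g ^ (N * n : ℤ) • y) (g ^ (N * n : ℤ) • s) =
        gromovProduct (g ^ (-(N * n : ℤ)) • s) s y := by
      rw [← gromovProduct_smul (g ^ (N * n : ℤ)) _ s y, smul_smul, ← zpow_add, add_neg_cancel,
        zpow_zero, one_smul, gromovProduct_comm]
    rw [dist_zpow_neg_smul] at h2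
    have h4 := hlong n hn
    linarith
  · rintro h hhH hh1 y ⟨k, hk⟩ ⟨l, hl⟩
    have hD := hHD h hhH
    have h1 := hC h (fun hh => hh1 (hH h hhH hh)) hD k l
    have h2 := gromovProduct_le_add_dist_base (h • s) s (h • y) (h • g ^ k • s)
    rw [gromovProduct_smul, dist_comm] at h2
    have h3 := hX s (h • g ^ k • s) (h • y) (g ^ l • s)
    rw [gromovProduct_comm _ _ (h • y)] at h3
    have h4 : T - |D| < min (gromovProduct s (h • y) (h • g ^ k • s))
        (gromovProduct s (h • y) (g ^ l • s)) := by
      have := le_abs_self D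
      have := abs_nonneg D
      exact lt_min (by linarith) (by linarith)
    have := le_abs_self C
    linarith

end PingPong

end AcylindricalPingPong

theorem mainTheorem1 {G : Type*} [Group G]
    (hG : ∀ F : Subgroup G, F.Normal → (F : Set G).Finite → F = ⊥)
    {X : Type*} [MetricSpace X] [MulAction G X] [IsIsometricSMul G X] (δ : ℝ)
    (hgeod : AcylindricalPingPong.IsGeodesicSpace X)
    (hhyp : AcylindricalPingPong.IsHyperbolicSpace δ X)
    (hne : AcylindricalPingPong.IsNonElementary X)
    (hacyl : AcylindricalPingPong.IsAcylindrical G X)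
    (hcob : AcylindricalPingPong.IsCobounded G X)
    {k : ℕ} (H : Fin k → Subgroup G)
    (hH : ∀ i, AcylindricalPingPong.IsEllipticSubgroup X (H i)) :
    ∃ g : G, AcylindricalPingPong.IsLoxodromic X g ∧
      (∀ i, H i ≠ ⊥ → ∀ r K : ℝ, Bornology.IsBounded
        (AcylindricalPingPong.quasiAxis X r g ∩ AcylindricalPingPong.quasiFix X K (H i))) ∧
      ∃ N₀ : ℕ, ∀ N : ℕ, N₀ ≤ N →
        AcylindricalPingPong.IsLoxodromic X (g ^ N) ∧
        ∀ i, AcylindricalPingPong.IsInternalFreeProduct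
          (Subgroup.closure ({g ^ N} ∪ (H i : Set G)))
          (Subgroup.zpowers (g ^ N)) (H i) := by
  have hbdd : ∀ y : X, ∃ D, ∀ h ∈ ⋃ i, (H i : Set G), dist y (h • y) ≤ D := by
    intro y
    choose D hD using fun i => (hH i).exists_dist_le hgeod hhyp hacyl y
    obtain ⟨E, hE⟩ := (Set.finite_range D).bddAbove
    refine ⟨E, fun h hh => ?_⟩
    obtain ⟨i, hi⟩ := Set.mem_iUnion.1 hh
    exact (hD i h hi).trans (hE ⟨i, rfl⟩)
  obtain ⟨f, s₀, hf⟩ := hne.exists_isStretchedAt hgeod hhyp hacyl hcob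
  obtain ⟨g, s, hg, hgH⟩ := hacyl.exists_isStretchedAt_inter_eq_one hG hhyp hne hcob hf hbdd
  obtain ⟨κ, hx⟩ := hg.exists_isQuasiLine hhyp
  obtain ⟨D, hD⟩ := hbdd s
  obtain ⟨N₀, hN₀⟩ := hacyl.exists_isInternalFreeProduct hhyp hx (D := D)
  refine ⟨g, ?_, fun i hi r K => ?_, max N₀ 1, fun N hN => ⟨?_, fun i => ?_⟩⟩
  · simpa using hx.isLoxodromic_pow one_pos
  · obtain ⟨h, hh, hh1⟩ := (H i).bot_or_exists_ne_one.resolve_left hi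
    exact hacyl.isBounded_quasiAxis_inter_quasiFix hhyp hx hh
      (fun hE => hh1 (hgH h (Set.mem_iUnion.2 ⟨i, hh⟩) hE)) r K
  · exact hx.isLoxodromic_pow (by omega)
  · exact hN₀ N (by omega) (H i) (fun h hh => hD h (Set.mem_iUnion.2 ⟨i, hh⟩))
      (fun h hh => hgH h (Set.mem_iUnion.2 ⟨i, hh⟩))
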